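/- **Setting.** For a positive integer $n$ one observes a Poisson process $N$ on $\mathbb R$ (a random countable set such that the number of points in each Borel set $A$ is Poisson distributed with mean $n\int_A f(x)\,dx$, and the numbers of points in finitely many pairwise disjoint Borel sets are independent), where $f\ge 0$, $f\in\mathbb L_1(\mathbb R)$, is the unknown intensity. An estimator $\hat f_n$ is a measurable function of the observed process. Let $\phi=\mathbf 1_{[0,1]}$ and $\psi=\mathbf 1_{[0,1/2]}-\mathbf 1_{(1/2,1]}$, and let $(\varphi_\lambda)_{\lambda\in\Lambda}$, $\Lambda=\{(j,k): j\ge -1,\ k\in\mathbb Z\}$, be the Haar basis: $\varphi_{(-1,k)}(x)=\phi(x-k)$ and $\varphi_{(j,k)}(x)=2^{j/2}\psi(2^jx-k)$ for $j\ge 0$. For $f\in\mathbb L_2(\mathbb R)$ put $\beta_\lambda=\int\varphi_\lambda f$ and $\sigma_\lambda^2=\int\varphi_\lambda^2 f$. For $n\ge2$ let $j_0(n)$ be the integer such that $2^{j_0(n)}\le n/\log n<2^{j_0(n)+1}$, and let $\Gamma_n=\{(j,k)\in\Lambda: j\le j_0(n)\}$. For $0<s<\frac12$ and $R>0$ let $$W_s(R)=\Big\{f:\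 \sup_{t>0}\,t^{-4s}\sum_{\lambda\in\Lambda}\beta_\lambda^2\mathbf 1_{|\beta_\lambda|\le\sigma_\lambda t}\le R^{2-4s}\Big\},\qquad B^s_{2,\Gamma}(R)=\Big\{f:\ \sup_{n\ge 2}\Big(\frac{\log n}{n}\Big)^{-2s}\sum_{\lambda\notin\Gamma_n}\beta_\lambda^2\le R^2\Big\},$$ $$\mathcal L_{1,2,\infty}(R)=\{f:\ \|f\|_1\le R,\ \|f\|_2\le R,\ \|f\|_\infty\le R\},\qquad \rho_{n,s}=\Big(\frac{\log n}{n}\Big)^s .$$ **Theorem 6.** For every $0<s<\frac12$ there is a constant $\tilde C(s)>0$, depending only on $s$, such that for all $R,R',R''>0$ with $R''\ge 1$ and $R'\ge R^{1-2s}\ge 1$, $$\liminf_{n\to\infty}\ \rho_{n,s}^{-2}\ \inf_{\hat f_n}\ \sup_{f\in W_s(R)\cap B^s_{2,\Gamma}(R')\cap\mathcal L_{1,2,\infty}(R'')}\ \mathbb E\big(\|\hat f_n-f\|_2^2\big)\ \ge\ \tilde C(s)\,R^{2-4s},$$ where the infimum is over all estimators $\hat f_n$ and the supremum is over the intensities $f\ge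 0$ in the class. -/

import Mathlib

open MeasureTheory ProbabilityTheory Filter
open scoped ENNReal

noncomputable section

namespace WeakBesov

/-! ### Poisson processes -/

/-- A realization of a point process on the line: a countable subset of `ℝ`. -/
structure Config where
  /-- The points of the configuration. -/
  points : Set ℝ
  countable : points.Countable

/-- The number `N_A` of points of the configuration lying in `A`. -/
def Config.count (A : Set ℝ) (S : Config) : ℕ∞ := (S.points ∩ A).encard

/-- The σ-algebra on configurations generated by the counts `N_A`, `A` Borel. -/
instance : MeasurableSpace Config :=
  ⨆ A : {A : Set ℝ // MeasurableSet A}, MeasurableSpace.comap (Config.count A.1) inferInstance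

/-- The Poisson distribution with parameter `r ∈ [0, ∞]` on `ℕ ∪ {∞}`; the parameter `∞` gives the
point mass at `∞`. -/
def poissonLaw (r : ℝ≥0∞) : Measure ℕ∞ :=
  if r = ⊤ then Measure.dirac ⊤ else (poissonMeasure r.toNNReal).map (Nat.cast : ℕ → ℕ∞)

/-- The random countable set `N`, defined on the probability space `(Ω, P)`, is a Poisson process
on `ℝ` with mean measure `μ`. -/
structure IsPoissonProcess {Ω : Type*} [MeasurableSpace Ω] (N : Ω → Config) (P : Measure Ω)
    (μ : Measure ℝ) : Prop where
  isProbabilityMeasure : IsProbabilityMeasure P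
  measurable : Measurable N
  law_count : ∀ A : Set ℝ, MeasurableSet A →
    P.map (fun ω => (N ω).count A) = poissonLaw (μ A)
  indep_count : ∀ (m : ℕ) (A : Fin m → Set ℝ), (∀ i, MeasurableSet (A i)) →
    Pairwise (fun i i' => Disjoint (A i) (A i')) →
    iIndepFun (fun i ω => (N ω).count (A i)) P

/-- `f` is an intensity and `P` is the law, on the space of configurations, of the
Poisson process with mean measure `n f(x) dx`. -/
structure IsPoissonModel (n : ℕ) (f : ℝ → ℝ) (P : Measure Config) : Prop where
  nonneg : 0 ≤ᵐ[volume] f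
  integrable : Integrable f volume
  poisson : IsPoissonProcess (fun S : Config => S) P
    (volume.withDensity (fun x => ENNReal.ofReal (n * f x)))

/-! ### Minimax risk -/

/-- The quadratic risk `E ‖f̂ - f‖₂²` (possibly infinite) of the estimator `fhat`, a function of
the observed configuration, when the configuration has law `P`. -/
def risk (P : Measure Config) (fhat : Config → ℝ → ℝ) (f : ℝ → ℝ) : ℝ≥0∞ :=
  ∫⁻ S, eLpNorm (fun x => fhat S x - f x) 2 volume ^ 2 ∂P

/-- The minimax risk over the class `F` for the Poisson process with mean measure `n f(x) dx`:
infimum over all (jointly measurable) estimators of the supremum over the intensities `f ∈ F`.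
For each intensity `f` there is exactly one law `P` in the inner supremum. -/
def minimaxRisk (n : ℕ) (F : Set (ℝ → ℝ)) : ℝ≥0∞ :=
  ⨅ (fhat : Config → ℝ → ℝ) (_ : Measurable (Function.uncurry fhat)),
    ⨆ (f : ℝ → ℝ) (_ : f ∈ F) (P : Measure Config) (_ : IsPoissonModel n f P), risk P fhat f

/-! ### The Haar basis -/

/-- The index set `Λ = {(j, k) : j ≥ -1, k ∈ ℤ}`. -/
abbrev Index : Type := {l : ℤ × ℤ // -1 ≤ l.1}

/-- The resolution level `j` of the index `(j, k)`. -/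
def Index.level (l : Index) : ℤ := l.1.1

/-- The location `k` of the index `(j, k)`. -/
def Index.shift (l : Index) : ℤ := l.1.2

/-- The father wavelet `1_{[0,1]}`. -/
def haarFather : ℝ → ℝ := (Set.Icc 0 1).indicator 1

/-- The mother wavelet `1_{[0,1/2]} - 1_{(1/2,1]}`. -/
def haarMother : ℝ → ℝ :=
  (Set.Icc 0 (1 / 2)).indicator 1 - (Set.Ioc (1 / 2) 1).indicator 1

/-- The Haar basis: `φ(x - k)` for `j = -1` and `2^{j/2} ψ(2^j x - k)` for `j ≥ 0`. -/
def haar (l : Index) (x : ℝ) : ℝ :=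
  if l.level = -1 then haarFather (x - l.shift)
  else (2 : ℝ) ^ ((l.level : ℝ) / 2) * haarMother ((2 : ℝ) ^ l.level * x - l.shift)

/-- The Haar coefficients `β_λ = ∫ φ_λ f`. -/
def coeff (f : ℝ → ℝ) (l : Index) : ℝ := ∫ x, haar l x * f x

/-- `σ_λ = (∫ φ_λ² f)^{1/2}`. -/
def sigma (f : ℝ → ℝ) (l : Index) : ℝ := √(∫ x, haar l x ^ 2 * f x)

/-! ### Function classes -/

/-- The ball `W_s(R)`: `sup_{t>0} t^{-4s} ∑_λ β_λ² 1_{|β_λ| ≤ σ_λ t} ≤ R^{2-4s}`. -/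
def weakBesovBall (s R : ℝ) : Set (ℝ → ℝ) :=
  {f | MemLp f 2 volume ∧
    (⨆ (t : ℝ) (_ : 0 < t), ENNReal.ofReal (t ^ (-4 * s)) *
      ∑' l : {l : Index // |coeff f l| ≤ sigma f l * t}, ENNReal.ofReal (coeff f l.1 ^ 2))
      ≤ ENNReal.ofReal (R ^ (2 - 4 * s))}

/-- The ball `B^s_{2,Γ}(R)`: `sup_n (log n / n)^{-2s} ∑_{λ ∉ Γ_n} β_λ² ≤ R²`. The supremum is over
`n ≥ 2`, since `log 1 = 0`. -/
def tailBall (Γ : ℕ → Set Index) (s R : ℝ) : Set (ℝ → ℝ) :=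
  {f | MemLp f 2 volume ∧
    (⨆ (n : ℕ) (_ : 2 ≤ n), ENNReal.ofReal ((Real.log n / n) ^ (-2 * s)) *
      ∑' l : {l : Index // l ∉ Γ n}, ENNReal.ofReal (coeff f l.1 ^ 2))
      ≤ ENNReal.ofReal (R ^ 2)}

/-- The class `𝓛_{1,2,∞}(R)` of functions whose `L₁`, `L₂` and `L_∞` norms are at most `R`. -/
def lebesgueBall (R : ℝ) : Set (ℝ → ℝ) :=
  {f | AEStronglyMeasurable f volume ∧ eLpNorm f 1 volume ≤ ENNReal.ofReal R ∧
    eLpNorm f 2 volume ≤ ENNReal.ofReal R ∧ eLpNorm f ⊤ volume ≤ ENNReal.ofReal R}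

/-- The integer `j₀` such that `2^{j₀} ≤ n / log n < 2^{j₀+1}`. -/
def maxLevel (n : ℕ) : ℤ := Int.log 2 ((n : ℝ) / Real.log n)

theorem maxLevel_spec (n : ℕ) (hn : 2 ≤ n) :
    (2 : ℝ) ^ maxLevel n ≤ n / Real.log n ∧ n / Real.log n < (2 : ℝ) ^ (maxLevel n + 1) := by
  have hpos : (0 : ℝ) < n / Real.log n :=
    div_pos (by positivity) (Real.log_pos (by exact_mod_cast hn))
  exact ⟨by exact_mod_cast Int.zpow_log_le_self (b := 2) one_lt_two hpos,
    by exact_mod_cast Int.lt_zpow_succ_log_self (b := 2) one_lt_two ((n : ℝ) / Real.log n)⟩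

/-- `Γ_n = {λ = (j, k) : j ≤ j₀(n)}`. -/
def levelSet (n : ℕ) : Set Index := {l | l.level ≤ maxLevel n}

/-- The rate `ρ_{n,s} = (log n / n)^s`. -/
def rate (s : ℝ) (n : ℕ) : ℝ := (Real.log n / n) ^ s

end WeakBesov

end

noncomputable section

namespace WeakBesov

/-! Start from intensity 1/2 on [0,1) and add Haar bumps of amplitude ε at `m` of the 2^j cells of
one level j, where 2^j ~ n / log n and ε² ~ s log n / n. Moving one bump changes f by order ε² in
squared norm, so the rate follows once the bumps cannot be located. Group the cells into `m` blocks
of `B` cells and put one bump in each. The likelihood ratio of one bump has second moment exp(2nε²)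
= n^s, while B is of order (n / log n)^(2s) / R^(2-4s), which is eventually much larger. Hence
within a block no estimator finds the bump: averaged over its position, the loss there is at least
ε²/8 (`sum_lintegral_blockLoss_ge`). Averaging over all choices of positions adds up the blocks and
gives mε²/8 (`le_of_forall_risk_le`). With m ~ R^(2-4s) (n / log n)^(1-2s) this is the claimed
bound. Class membership is read off the coefficients: 1/2 for the father, ε at the chosen cells, 0
elsewhere, with σ² = 1/2 at each nonzero one (`intensity_mem_weakBesovBall`,
`intensity_mem_tailBall`). The models are realised as a Poisson(n/2) number of points, with
likelihood a product over the points. The exponential formula shows that they are Poisson processes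
(`isPoissonProcess_map_toConfig`) and computes the second moments. -/

/-! ### Poisson samples -/

/-- A Poisson number of points together with an infinite sequence of locations. -/
abbrev Sample : Type := ℕ × (ℕ → ℝ)

/-- A Poisson number of independent points with common law `ν`. -/
def sampleLaw (r : NNReal) (ν : Measure ℝ) [IsProbabilityMeasure ν] : Measure Sample :=
  (poissonMeasure r).prod (Measure.infinitePi fun _ : ℕ => ν)

/-- The product of the values of `F` over the points of a sample. -/
def sampleProd {M : Type*} [CommMonoid M] (F : ℝ → M) (ω : Sample) : M :=
  ∏ i ∈ Finset.range ω.1, F (ω.2 i)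

/-! ### Exponential formula for multiplicative functionals of a Poisson sample. -/

section Product

variable {r : NNReal} {ν : Measure ℝ} [IsProbabilityMeasure ν]

instance : IsProbabilityMeasure (sampleLaw r ν) := by
  unfold sampleLaw; infer_instance

theorem sampleProd_mul {M : Type*} [CommMonoid M] (F G : ℝ → M) (ω : Sample) :
    sampleProd (fun x => F x * G x) ω = sampleProd F ω * sampleProd G ω :=
  Finset.prod_mul_distrib

@[fun_prop]
theorem measurable_sampleProd {M : Type*} [CommMonoid M] [MeasurableSpace M] [MeasurableMul₂ M]
    {F : ℝ → M} (hF : Measurable F) : Measurable (sampleProd F) := by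
  refine measurable_from_prod_countable_right fun N => ?_
  exact Finset.measurable_fun_prod (Finset.range N) fun i _ => hF.comp (measurable_pi_apply i)

theorem lintegral_prod_infinitePi {G : ℝ → ℝ≥0∞} (hG : Measurable G) (N : ℕ) :
    ∫⁻ X, ∏ i ∈ Finset.range N, G (X i) ∂(Measure.infinitePi fun _ : ℕ => ν)
      = (∫⁻ x, G x ∂ν) ^ N := by
  have h := lintegral_prod_eq_prod_lintegral_of_indepFun (Finset.range N)
    (fun (i : ℕ) (X : ℕ → ℝ) => G (X i))
    (iIndepFun_infinitePi (P := fun _ : ℕ => ν) (X := fun _ => G) fun _ => hG)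
    (fun i => by fun_prop)
  rw [h, Finset.prod_congr rfl (g := fun _ => ∫⁻ x, G x ∂ν), Finset.prod_const, Finset.card_range]
  intro i _
  exact (measurePreserving_eval_infinitePi (fun _ : ℕ => ν) i).lintegral_comp hG

theorem integral_prod_infinitePi {G : ℝ → ℂ} (hG : Measurable G) (N : ℕ) :
    ∫ X, ∏ i ∈ Finset.range N, G (X i) ∂(Measure.infinitePi fun _ : ℕ => ν)
      = (∫ x, G x ∂ν) ^ N := by
  have h := integral_restrict_infinitePi (μ := fun _ : ℕ => ν) (s := Finset.range N)
    (f := fun y => ∏ i, G (y i)) (Measurable.aestronglyMeasurable (by fun_prop))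
  rw [integral_fintype_prod_eq_pow (μ := ν)] at h
  rw [Fintype.card_coe, Finset.card_range] at h
  rw [← h]
  congr 1 with X
  exact (Finset.prod_coe_sort (Finset.range N) fun i => G (X i)).symm

/-- Given N points, independence yields g^N; summing against the Poisson weights gives the
exponential. Masses and second moments of likelihoods are instances of this. -/
theorem lintegral_sampleProd {G : ℝ → ℝ≥0∞} (hG : Measurable G) {g : ℝ} (hg : 0 ≤ g)
    (h : ∫⁻ x, G x ∂ν = ENNReal.ofReal g) :
    ∫⁻ ω, sampleProd G ω ∂(sampleLaw r ν) = ENNReal.ofReal (Real.exp (r * (g - 1))) := by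
  rw [sampleLaw, lintegral_prod _ (measurable_sampleProd hG).aemeasurable]
  simp only [sampleProd, lintegral_prod_infinitePi hG, h]
  rw [poissonMeasure, lintegral_sum_measure]
  simp only [lintegral_smul_measure, lintegral_dirac, smul_eq_mul]
  have hs : HasSum (fun N : ℕ => Real.exp (-r) * r ^ N / N.factorial * g ^ N)
      (Real.exp (r * (g - 1))) := by
    have := (NormedSpace.expSeries_div_hasSum_exp (r * g : ℝ)).mul_left (Real.exp (-r))
    rw [← Real.exp_eq_exp_ℝ, ← Real.exp_add] at this
    convert! this using 2
    · rw [mul_pow]; ring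
    · ring
  rw [← hs.tsum_eq, ENNReal.ofReal_tsum_of_nonneg (fun N => by positivity) hs.summable]
  congr 1 with N
  rw [ENNReal.ofReal_mul (by positivity), ENNReal.ofReal_pow hg]

theorem integrable_sampleProd {F : ℝ → ℂ} (hF : Measurable F) (hi : Integrable F ν) :
    Integrable (sampleProd F) (sampleLaw r ν) := by
  refine ⟨(measurable_sampleProd hF).aestronglyMeasurable, ?_⟩
  have h : ∀ ω, ‖sampleProd F ω‖ₑ = sampleProd (fun x => ‖F x‖ₑ) ω := fun ω => by
    simp only [sampleProd, enorm_eq_nnnorm, nnnorm_prod, ENNReal.ofNNReal_finsetProd]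
  simp only [HasFiniteIntegral, h]
  rw [lintegral_sampleProd (by fun_prop) ENNReal.toReal_nonneg
    (ENNReal.ofReal_toReal hi.hasFiniteIntegral.ne).symm]
  exact ENNReal.ofReal_lt_top

/-- Complex counterpart, needed for characteristic functions of counts. -/
theorem integral_sampleProd {F : ℝ → ℂ} (hF : Measurable F) (hi : Integrable F ν) :
    ∫ ω, sampleProd F ω ∂(sampleLaw r ν) = Complex.exp (r * (∫ x, F x ∂ν - 1)) := by
  have hint := integrable_sampleProd (r := r) hF hi
  rw [sampleLaw] at hint ⊢
  rw [integral_prod _ hint]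
  simp only [sampleProd, integral_prod_infinitePi hF]
  rw [integral_poissonMeasure]
  set z := ∫ x, F x ∂ν
  have := (NormedSpace.expSeries_div_hasSum_exp (r * z : ℂ)).mul_left (Complex.exp (-r))
  rw [← Complex.exp_eq_exp_ℂ, ← Complex.exp_add] at this
  rw [show (r : ℂ) * (z - 1) = -r + r * z by ring, ← this.tsum_eq]
  congr 1 with N
  rw [Complex.real_smul]
  push_cast
  rw [mul_pow]; ring

end Product

/-! ### Tilted samples and the Poisson processes they generate. -/

section Tilted

/-- The law of a Poisson sample whose points have density `g` with respect to `ν`. -/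
def tiltedLaw (r : NNReal) (ν : Measure ℝ) [IsProbabilityMeasure ν] (g : ℝ → ℝ) :
    Measure Sample :=
  (sampleLaw r ν).withDensity (sampleProd fun x => ENNReal.ofReal (g x))

variable {r : NNReal} {ν : Measure ℝ} [IsProbabilityMeasure ν] {g : ℝ → ℝ}

/-- Since `g` has mean one, the exponential formula gives total mass exp 0; no normalising factor is
needed. -/
theorem isProbabilityMeasure_tiltedLaw (hg : Measurable g)
    (h1 : ∫⁻ x, ENNReal.ofReal (g x) ∂ν = 1) : IsProbabilityMeasure (tiltedLaw r ν g) := by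
  constructor
  rw [tiltedLaw, withDensity_apply _ MeasurableSet.univ, setLIntegral_univ,
    lintegral_sampleProd (by fun_prop) zero_le_one (by simpa using h1)]
  simp

theorem integral_tiltedLaw (hg : Measurable g) (h0 : ∀ x, 0 ≤ g x) {F : ℝ → ℂ}
    (hF : Measurable F) (hi : Integrable (fun x => g x * F x) ν) :
    ∫ ω, sampleProd F ω ∂(tiltedLaw r ν g)
      = Complex.exp (r * (∫ x, g x * F x ∂ν - 1)) := by
  rw [tiltedLaw, integral_withDensity_eq_integral_toReal_smul (by fun_prop)]
  · rw [← integral_sampleProd (by fun_prop) hi]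
    congr 1 with ω
    simp only [sampleProd, ENNReal.toReal_prod, Finset.prod_mul_distrib, Complex.real_smul,
      Complex.ofReal_prod, ENNReal.toReal_ofReal (h0 _)]
  · refine Eventually.of_forall fun ω => ?_
    exact ENNReal.prod_lt_top fun i _ => ENNReal.ofReal_lt_top

/-- The number of points of a sample in `A`. -/
def numIn (A : Set ℝ) (ω : Sample) : ℕ :=
  ∑ i ∈ Finset.range ω.1, A.indicator 1 (ω.2 i)

theorem measurable_numIn {A : Set ℝ} (hA : MeasurableSet A) : Measurable (numIn A) := by
  refine measurable_from_prod_countable_right fun N => ?_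
  have hind : Measurable (A.indicator (1 : ℝ → ℕ)) := measurable_one.indicator hA
  exact Finset.measurable_fun_sum (Finset.range N) fun i _ => hind.comp (measurable_pi_apply i)

theorem exp_sum_numIn {m : ℕ} (A : Fin m → Set ℝ) (t : Fin m → ℝ) (ω : Sample) :
    Complex.exp (((∑ l, (numIn (A l) ω : ℝ) * t l : ℝ) : ℂ) * Complex.I)
      = sampleProd (fun x => Complex.exp
          (((∑ l, (A l).indicator 1 x * t l : ℝ) : ℂ) * Complex.I)) ω := by
  rw [sampleProd, ← Complex.exp_sum, ← Finset.sum_mul, ← Complex.ofReal_sum, Finset.sum_comm]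
  congr 4 with l
  rw [← Finset.sum_mul, numIn]
  push_cast
  congr 2 with i
  by_cases h : ω.2 i ∈ A l <;> simp [h]

/-- At most one of the disjoint sets contains `x`, so the exponential of the sum is linear in the
indicators. The exponential formula then has a sum over the sets in its exponent, that is, a product
outside. -/
theorem exp_sum_indicator {m : ℕ} {A : Fin m → Set ℝ}
    (hd : Pairwise fun i i' => Disjoint (A i) (A i')) (t : Fin m → ℝ) (x : ℝ) :
    Complex.exp (((∑ l, (A l).indicator 1 x * t l : ℝ) : ℂ) * Complex.I)
      = 1 + ∑ l, (A l).indicator (fun _ => Complex.exp (t l * Complex.I) - 1) x := by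
  by_cases h : ∃ l, x ∈ A l
  · obtain ⟨l, hl⟩ := h
    have hne : ∀ l', l' ≠ l → x ∉ A l' := fun l' hl' hx =>
      Set.disjoint_left.1 (hd hl') hx hl
    rw [Finset.sum_eq_single l (fun l' _ h' => by simp [hne l' h']) (by simp),
      Finset.sum_eq_single l (fun l' _ h' => by simp [hne l' h']) (by simp)]
    simp [hl]
  · push Not at h
    simp [h]

/-- The joint characteristic function of counts on disjoint sets factors into Poisson ones; it
yields both the law of each count and the independence. -/
theorem integral_exp_numIn (hg : Measurable g) (h0 : ∀ x, 0 ≤ g x) (hi : Integrable g ν)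
    (h1 : ∫ x, g x ∂ν = 1) {m : ℕ} {A : Fin m → Set ℝ} (hA : ∀ l, MeasurableSet (A l))
    (hd : Pairwise fun i i' => Disjoint (A i) (A i')) (t : Fin m → ℝ) :
    ∫ ω, Complex.exp (((∑ l, (numIn (A l) ω : ℝ) * t l : ℝ) : ℂ) * Complex.I)
        ∂(tiltedLaw r ν g)
      = ∏ l, Complex.exp (r * (∫ x in A l, g x ∂ν : ℝ) * (Complex.exp (t l * Complex.I) - 1)) := by
  simp_rw [exp_sum_numIn, exp_sum_indicator hd]
  have hi' : Integrable (fun x => (g x : ℂ)) ν := hi.ofReal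
  have hterm : ∀ l, Integrable (fun x => (g x : ℂ) *
      (A l).indicator (fun _ => Complex.exp (t l * Complex.I) - 1) x) ν := fun l => by
    have := (hi'.mul_const (Complex.exp (t l * Complex.I) - 1)).indicator (hA l)
    refine this.congr (Eventually.of_forall fun x => ?_)
    by_cases h : x ∈ A l <;> simp [h]
  have hexp : ∀ x, (g x : ℂ) * (1 + ∑ l, (A l).indicator
      (fun _ => Complex.exp (t l * Complex.I) - 1) x) = g x + ∑ l, (g x : ℂ) *
      (A l).indicator (fun _ => Complex.exp (t l * Complex.I) - 1) x := fun x => by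
    rw [mul_add, mul_one, Finset.mul_sum]
  have hsum : Integrable (fun x => ∑ l, (g x : ℂ) *
      (A l).indicator (fun _ => Complex.exp (t l * Complex.I) - 1) x) ν :=
    integrable_finsetSum _ fun l _ => hterm l
  rw [integral_tiltedLaw hg h0]
  · simp_rw [hexp]
    rw [integral_add hi' hsum, integral_finsetSum _ fun l _ => hterm l,
      integral_complex_ofReal, h1, ← Complex.exp_sum]
    congr 1
    rw [Complex.ofReal_one, add_sub_cancel_left, Finset.mul_sum]
    congr 1 with l
    rw [mul_assoc]
    congr 1
    rw [← integral_complex_ofReal, ← integral_mul_const, ← integral_indicator (hA l)]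
    congr 1 with x
    by_cases h : x ∈ A l <;> simp [h]
  · exact measurable_const.add
      (Finset.measurable_sum _ fun l _ => measurable_const.indicator (hA l))
  · simp_rw [hexp]
    exact hi'.add hsum

theorem charFun_map_numIn [IsProbabilityMeasure (tiltedLaw r ν g)] (hg : Measurable g)
    (h0 : ∀ x, 0 ≤ g x) (hi : Integrable g ν) (h1 : ∫ x, g x ∂ν = 1) {A : Set ℝ}
    (hA : MeasurableSet A) (t : ℝ) :
    charFun ((tiltedLaw r ν g).map fun ω => (numIn A ω : ℝ)) t
      = Complex.exp (r * (∫ x in A, g x ∂ν : ℝ) * (Complex.exp (t * Complex.I) - 1)) := by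
  have h := integral_exp_numIn (r := r) hg h0 hi h1 (A := fun _ : Fin 1 => A) (fun _ => hA)
    (fun i j hij => absurd (Subsingleton.elim i j) hij) (fun _ => t)
  simp only [Fin.prod_univ_one, Fin.sum_univ_one] at h
  have hm : Measurable fun ω => (numIn A ω : ℝ) := measurable_from_nat.comp (measurable_numIn hA)
  rw [← h, charFun_apply, integral_map hm.aemeasurable (by fun_prop)]
  congr 1 with ω
  simp [mul_comm]

theorem map_numIn [IsProbabilityMeasure (tiltedLaw r ν g)] (hg : Measurable g)
    (h0 : ∀ x, 0 ≤ g x) (hi : Integrable g ν) (h1 : ∫ x, g x ∂ν = 1) {A : Set ℝ}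
    (hA : MeasurableSet A) :
    (tiltedLaw r ν g).map (numIn A)
      = poissonMeasure (r * (∫ x in A, g x ∂ν).toNNReal) := by
  apply (MeasurableEmbedding.natCast (α := ℝ)).map_injective
  rw [Measure.map_map measurable_from_nat (measurable_numIn hA)]
  have := Measure.isProbabilityMeasure_map (μ := tiltedLaw r ν g)
    (measurable_from_nat (f := (Nat.cast : ℕ → ℝ)).comp (measurable_numIn hA)).aemeasurable
  apply Measure.ext_of_charFun
  ext t
  rw [charFun_map_cast_poissonMeasure]
  refine (charFun_map_numIn hg h0 hi h1 hA t).trans ?_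
  rw [NNReal.coe_mul, Real.coe_toNNReal _ (integral_nonneg h0)]
  push_cast
  rfl

theorem iIndepFun_numIn [IsProbabilityMeasure (tiltedLaw r ν g)] (hg : Measurable g)
    (h0 : ∀ x, 0 ≤ g x) (hi : Integrable g ν) (h1 : ∫ x, g x ∂ν = 1) {m : ℕ}
    {A : Fin m → Set ℝ} (hA : ∀ l, MeasurableSet (A l))
    (hd : Pairwise fun i i' => Disjoint (A i) (A i')) :
    iIndepFun (fun l => numIn (A l)) (tiltedLaw r ν g) := by
  have hm : ∀ l, Measurable fun ω => (numIn (A l) ω : ℝ) := fun l =>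
    measurable_from_nat.comp (measurable_numIn (hA l))
  have key : iIndepFun (fun l ω => (numIn (A l) ω : ℝ)) (tiltedLaw r ν g) := by
    rw [iIndepFun_iff_charFun_pi fun l => (hm l).aemeasurable]
    intro t
    simp_rw [charFun_map_numIn hg h0 hi h1 (hA _)]
    have hm' : Measurable fun ω => WithLp.toLp 2 fun l => (numIn (A l) ω : ℝ) :=
      (WithLp.measurable_toLp 2 _).comp (measurable_pi_lambda _ hm)
    rw [← integral_exp_numIn hg h0 hi h1 hA hd, charFun_apply,
      integral_map hm'.aemeasurable (by fun_prop)]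
    congr 1 with ω
    simp [PiLp.inner_apply, mul_comm]
  -- The floor recovers the natural-valued counts from their real casts.
  convert! key.comp (fun _ x => ⌊x⌋₊) (fun _ => Nat.measurable_floor) with l
  ext ω
  simp

open Classical in
/-- The configuration of the points of a sample, set to be empty if the sequence of locations has
a repetition. -/
def toConfig (ω : Sample) : Config :=
  if Function.Injective ω.2 then ⟨ω.2 '' Set.Iio ω.1, (Set.to_countable _).image _⟩
  else ⟨∅, Set.countable_empty⟩

theorem count_toConfig {ω : Sample} (hω : Function.Injective ω.2) (A : Set ℝ) :
    (toConfig ω).count A = numIn A ω := by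
  classical
  have hset : (ω.2 '' Set.Iio ω.1) ∩ A
      = ω.2 '' ((Finset.range ω.1).filter fun i => ω.2 i ∈ A : Finset ℕ) := by
    ext x
    simp only [Set.mem_inter_iff, Set.mem_image, Set.mem_Iio, Finset.coe_filter, Finset.mem_range,
      Set.mem_ofPred_eq]
    constructor
    · rintro ⟨⟨i, hi, rfl⟩, hx⟩
      exact ⟨i, ⟨hi, hx⟩, rfl⟩
    · rintro ⟨i, ⟨hi, hx⟩, rfl⟩
      exact ⟨⟨i, hi, rfl⟩, hx⟩
  simp only [toConfig, hω, if_true, Config.count, hset]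
  rw [hω.encard_image, Set.encard_coe_eq_coe_finsetCard, Finset.card_filter, numIn]
  congr 2 with i

theorem measurableSet_injective : MeasurableSet {X : ℕ → ℝ | Function.Injective X} := by
  have : {X : ℕ → ℝ | Function.Injective X} = ⋂ i, ⋂ j, ⋂ (_ : i ≠ j), {X | X i = X j}ᶜ := by
    ext X
    simp only [Set.mem_ofPred_eq, Set.mem_iInter, Set.mem_compl_iff]
    exact ⟨fun h i j hij he => hij (h he), fun h i j he => by_contra fun hij => h i j hij he⟩
  rw [this]
  refine MeasurableSet.iInter fun i => MeasurableSet.iInter fun j => MeasurableSet.iInter fun _ =>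
    (measurableSet_eq_fun (measurable_pi_apply i) (measurable_pi_apply j)).compl

theorem measurable_toConfig : Measurable toConfig := by
  classical
  refine measurable_iff_comap_le.2 ?_
  rw [instMeasurableSpaceConfig, MeasurableSpace.comap_iSup]
  refine iSup_le fun A => ?_
  rw [MeasurableSpace.comap_comp, ← measurable_iff_comap_le]
  have : Config.count A.1 ∘ toConfig
      = fun ω => if Function.Injective ω.2 then (numIn A.1 ω : ℕ∞) else 0 := by
    ext1 ω
    by_cases h : Function.Injective ω.2
    · simp [h, count_toConfig]
    · simp [h, toConfig, Config.count]
  rw [this]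
  exact Measurable.ite (measurable_snd measurableSet_injective)
    (measurable_from_nat.comp (measurable_numIn A.2)) measurable_const

/-- Without atoms, each of the countably many pairs of coordinates is almost surely distinct, and
tilting preserves null sets. Thus replacing the sample by a set loses no multiplicity. -/
theorem ae_injective [NullSingletonClass ν] : ∀ᵐ ω ∂(tiltedLaw r ν g), Function.Injective ω.2 := by
  refine (withDensity_absolutelyContinuous _ _).ae_le ?_
  refine Measure.quasiMeasurePreserving_snd.ae (p := fun X : ℕ → ℝ => Function.Injective X) ?_
  have : ∀ᵐ X ∂(Measure.infinitePi fun _ : ℕ => ν), ∀ i j : ℕ, i ≠ j → X i ≠ X j := by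
    refine ae_all_iff.2 fun i => ae_all_iff.2 fun j => ?_
    by_cases hij : i = j
    · simp [hij]
    have hmp : (Measure.infinitePi fun _ : ℕ => ν).map (fun X => (X i, X j)) = ν.prod ν :=
      Measure.infinitePi_map_eval_prod hij
    have hd : ∀ᵐ p ∂(ν.prod ν), p.1 ≠ p.2 := by
      refine (Measure.ae_prod_iff_ae_ae
        (measurableSet_eq_fun measurable_fst measurable_snd).compl).2 ?_
      refine Eventually.of_forall fun x => ?_
      filter_upwards [compl_mem_ae_iff.2 (measure_singleton (μ := ν) x)] with y hy
      exact fun h => hy h.symm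
    rw [← hmp] at hd
    filter_upwards [ae_of_ae_map (by fun_prop) hd] with X hX _
    exact hX
  filter_upwards [this] with X hX i j he
  exact by_contra fun hij => hX i j hij he

/-- The configurations of tilted samples form a Poisson process. -/
theorem isPoissonProcess_map_toConfig [NullSingletonClass ν] (hg : Measurable g)
    (h0 : ∀ x, 0 ≤ g x) (hi : Integrable g ν) (h1 : ∫ x, g x ∂ν = 1) {μ : Measure ℝ}
    (hμ : ∀ A, MeasurableSet A → μ A = ENNReal.ofReal (r * ∫ x in A, g x ∂ν)) :
    IsPoissonProcess (fun S : Config => S) ((tiltedLaw r ν g).map toConfig) μ := by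
  have hp : IsProbabilityMeasure (tiltedLaw r ν g) := isProbabilityMeasure_tiltedLaw hg (by
    rw [← ofReal_integral_eq_lintegral_ofReal hi (Eventually.of_forall h0), h1, ENNReal.ofReal_one])
  have hcount : ∀ A, MeasurableSet A → Measurable (Config.count A) := fun A hA =>
    measurable_iff_comap_le.2 (le_iSup (fun A : {A : Set ℝ // MeasurableSet A} =>
      MeasurableSpace.comap (Config.count A.1) inferInstance) ⟨A, hA⟩)
  have hae : ∀ A, (fun ω => (toConfig ω).count A) =ᵐ[tiltedLaw r ν g]
      fun ω => (numIn A ω : ℕ∞) := fun A => by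
    filter_upwards [ae_injective] with ω hω using count_toConfig hω A
  refine ⟨Measure.isProbabilityMeasure_map measurable_toConfig.aemeasurable, measurable_id,
    fun A hA => ?_, fun m A hA hd => ?_⟩
  · rw [Measure.map_map (hcount A hA) measurable_toConfig]
    refine (Measure.map_congr (hae A)).trans ?_
    rw [hμ A hA, poissonLaw, if_neg ENNReal.ofReal_ne_top]
    have : (ENNReal.ofReal (r * ∫ x in A, g x ∂ν)).toNNReal
        = r * (∫ x in A, g x ∂ν).toNNReal := by
      rw [ENNReal.ofReal, ENNReal.toNNReal_coe, Real.toNNReal_mul r.coe_nonneg, Real.toNNReal_coe]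
    rw [this, ← map_numIn hg h0 hi h1 hA, Measure.map_map measurable_from_nat (measurable_numIn hA)]
    rfl
  · have hind := ((iIndepFun_numIn hg h0 hi h1 hA hd).comp (fun _ => (Nat.cast : ℕ → ℕ∞))
      (fun _ => measurable_from_nat)).congr (fun l => (hae (A l)).symm)
    have hp' : IsProbabilityMeasure ((tiltedLaw r ν g).map toConfig) :=
      Measure.isProbabilityMeasure_map measurable_toConfig.aemeasurable
    have hm : ∀ l, Measurable fun ω => (toConfig ω).count (A l) := fun l =>
      (hcount _ (hA l)).comp measurable_toConfig
    rw [iIndepFun_iff_map_fun_eq_pi_map fun l => (hm l).aemeasurable] at hind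
    rw [iIndepFun_iff_map_fun_eq_pi_map (fun l => (hcount _ (hA l)).aemeasurable),
      Measure.map_map (measurable_pi_lambda _ fun l => hcount _ (hA l)) measurable_toConfig]
    refine Eq.trans hind ?_
    congr 1 with l : 1
    rw [Measure.map_map (hcount _ (hA l)) measurable_toConfig]
    rfl

end Tilted

/-! ### The half-open Haar system -/

/-- The index of the half-open dyadic cell of side `2⁻ʲ` that contains `x`. -/
def dyad (j : ℕ) (x : ℝ) : ℤ := ⌊(2 : ℝ) ^ j * x⌋

theorem dyad_eq_iff {j : ℕ} {x : ℝ} {q : ℤ} :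
    dyad j x = q ↔ (q : ℝ) ≤ 2 ^ j * x ∧ 2 ^ j * x < q + 1 := Int.floor_eq_iff

/-- Nesting of dyadic cells as integer division, so that support questions become integer
arithmetic. -/
theorem dyad_eq_ediv (j i : ℕ) (x : ℝ) : dyad j x = dyad (j + i) x / 2 ^ i := by
  have := Int.cast_mul_floor_div_cancel_of_pos (n := (2 : ℤ) ^ i) (by positivity)
    ((2 : ℝ) ^ j * x)
  rw [dyad, dyad, ← this]
  push_cast
  rw [pow_add]
  ring_nf

@[fun_prop]
theorem measurable_dyad (j : ℕ) : Measurable (dyad j) :=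
  Int.measurable_floor.comp (measurable_const.mul measurable_id)

theorem setOf_dyad_eq (j : ℕ) (q : ℤ) :
    {x | dyad j x = q} = Set.Ico ((q : ℝ) / 2 ^ j) ((q + 1) / 2 ^ j) := by
  ext x
  have h : (0 : ℝ) < 2 ^ j := by positivity
  simp only [Set.mem_ofPred_eq, dyad_eq_iff, Set.mem_Ico, div_le_iff₀ h, lt_div_iff₀ h, mul_comm]

theorem measurableSet_dyad_eq (j : ℕ) (q : ℤ) : MeasurableSet {x | dyad j x = q} :=
  measurable_dyad j (measurableSet_singleton q)

theorem volume_dyad_eq (j : ℕ) (q : ℤ) :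
    volume {x | dyad j x = q} = ENNReal.ofReal (1 / 2 ^ j) := by
  rw [setOf_dyad_eq, Real.volume_Ico]
  congr 1
  ring

theorem volume_real_dyad_eq (j : ℕ) (q : ℤ) : volume.real {x | dyad j x = q} = 1 / 2 ^ j := by
  rw [Measure.real, volume_dyad_eq, ENNReal.toReal_ofReal (by positivity)]

/-- The indicator function of a dyadic cell. -/
def cell (j : ℕ) (q : ℤ) : ℝ → ℝ := {x | dyad j x = q}.indicator 1

theorem cell_apply (j : ℕ) (q : ℤ) (x : ℝ) : cell j q x = if dyad j x = q then 1 else 0 := by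
  classical
  simp [cell, Set.indicator_apply]

@[fun_prop]
theorem measurable_cell (j : ℕ) (q : ℤ) : Measurable (cell j q) :=
  measurable_one.indicator (measurableSet_dyad_eq j q)

theorem integrable_cell (j : ℕ) (q : ℤ) : Integrable (cell j q) :=
  (integrable_indicator_iff (measurableSet_dyad_eq j q)).2 (integrableOn_const (by
    rw [volume_dyad_eq]; exact ENNReal.ofReal_ne_top))

theorem integral_cell (j : ℕ) (q : ℤ) : ∫ x, cell j q x = 1 / 2 ^ j := by
  rw [cell, integral_indicator_one (measurableSet_dyad_eq j q), volume_real_dyad_eq]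

/-- The Haar functions, with half-open cells. -/
def mother (j : ℕ) (k : ℤ) (x : ℝ) : ℝ :=
  (2 : ℝ) ^ ((j : ℝ) / 2) * (cell (j + 1) (2 * k) x - cell (j + 1) (2 * k + 1) x)

theorem amplitude_sq (j : ℕ) : ((2 : ℝ) ^ ((j : ℝ) / 2)) ^ 2 = 2 ^ j := by
  rw [← Real.rpow_natCast, ← Real.rpow_mul zero_le_two, ← Real.rpow_natCast]
  congr 1
  push_cast
  ring

@[fun_prop]
theorem measurable_mother (j : ℕ) (k : ℤ) : Measurable (mother j k) := by
  unfold mother; fun_prop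

theorem integrable_mother (j : ℕ) (k : ℤ) : Integrable (mother j k) :=
  ((integrable_cell _ _).sub (integrable_cell _ _)).const_mul _

theorem integral_mother (j : ℕ) (k : ℤ) : ∫ x, mother j k x = 0 := by
  simp only [mother]
  rw [integral_const_mul, integral_sub (integrable_cell _ _) (integrable_cell _ _),
    integral_cell, integral_cell, sub_self, mul_zero]

theorem mother_eq_zero {j : ℕ} {k : ℤ} {x : ℝ} (h : dyad j x ≠ k) : mother j k x = 0 := by
  have h1 := dyad_eq_ediv j 1 x
  have h2 : dyad (j + 1) x ≠ 2 * k := fun h' => h (by rw [h1, h']; omega)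
  have h3 : dyad (j + 1) x ≠ 2 * k + 1 := fun h' => h (by rw [h1, h']; omega)
  simp [mother, cell_apply, h2, h3]

theorem mother_sq (j : ℕ) (k : ℤ) (x : ℝ) : mother j k x ^ 2 = 2 ^ j * cell j k x := by
  have h1 := dyad_eq_ediv j 1 x
  rw [mother, mul_pow, amplitude_sq]
  congr 1
  simp only [cell_apply, h1]
  split_ifs <;> first | omega | norm_num

theorem abs_mother_le (j : ℕ) (k : ℤ) (x : ℝ) : |mother j k x| ≤ (2 : ℝ) ^ ((j : ℝ) / 2) := by
  refine abs_le_of_sq_le_sq ?_ (by positivity)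
  rw [mother_sq, amplitude_sq, cell_apply]
  split_ifs <;> simp

theorem mother_mul_mother {j : ℕ} {k k' : ℤ} (h : k ≠ k') (x : ℝ) :
    mother j k x * mother j k' x = 0 := by
  by_cases hx : dyad j x = k
  · rw [mother_eq_zero (k := k') (by rwa [hx]), mul_zero]
  · rw [mother_eq_zero hx, zero_mul]

/-- A function constant on level-`j` cells acts as a scalar on a level-`j` Haar function.
Orthogonality to everything coarser follows from the zero mean. -/
theorem comp_dyad_mul_mother (G : ℤ → ℝ) (j : ℕ) (k : ℤ) (x : ℝ) :
    G (dyad j x) * mother j k x = G k * mother j k x := by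
  by_cases hx : dyad j x = k
  · rw [hx]
  · rw [mother_eq_zero hx, mul_zero, mul_zero]

theorem cell_mul_mother {i j : ℕ} (hij : i ≤ j) (q k : ℤ) (x : ℝ) :
    cell i q x * mother j k x = (if k / 2 ^ (j - i) = q then 1 else 0) * mother j k x := by
  rw [← comp_dyad_mul_mother (fun z => if z / 2 ^ (j - i) = q then 1 else 0), cell_apply,
    dyad_eq_ediv i (j - i), Nat.add_sub_cancel' hij]

theorem integral_cell_mul_mother {i j : ℕ} (hij : i ≤ j) (q k : ℤ) :
    ∫ x, cell i q x * mother j k x = 0 := by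
  simp_rw [cell_mul_mother hij, integral_const_mul, integral_mother, mul_zero]

theorem integral_mother_mul_mother_of_lt {i j : ℕ} (hij : i < j) (q k : ℤ) :
    ∫ x, mother i q x * mother j k x = 0 := by
  have h : ∀ x, mother i q x * mother j k x = (2 : ℝ) ^ ((i : ℝ) / 2) *
      ((if (k / 2 ^ (j - (i + 1)) = 2 * q) then 1 else 0)
        - (if (k / 2 ^ (j - (i + 1)) = 2 * q + 1) then 1 else 0)) * mother j k x := fun x => by
    rw [mul_assoc, sub_mul, ← cell_mul_mother hij, ← cell_mul_mother hij, mother]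
    ring
  simp_rw [h, integral_const_mul, integral_mother, mul_zero]

theorem integral_mother_mul_mother (i j : ℕ) (q k : ℤ) :
    ∫ x, mother i q x * mother j k x = if i = j ∧ q = k then 1 else 0 := by
  rcases lt_trichotomy i j with h | rfl | h
  · rw [integral_mother_mul_mother_of_lt h, if_neg (by omega)]
  · by_cases hq : q = k
    · subst hq
      simp_rw [← sq, mother_sq, integral_const_mul, integral_cell]
      simp
    · simp_rw [mother_mul_mother hq, integral_zero]
      simp [hq]
  · simp_rw [mul_comm (mother i q _)]
    rw [integral_mother_mul_mother_of_lt h, if_neg (by omega)]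

theorem haar_father_ae (l : Index) (h : l.level = -1) : haar l =ᵐ[volume] cell 0 l.shift := by
  have : ∀ᵐ x : ℝ, x ≠ (l.shift : ℝ) + 1 := (compl_mem_ae_iff.2 (measure_singleton _))
  filter_upwards [this] with x hx
  classical
  simp only [haar, h, if_true, haarFather, cell_apply, dyad_eq_iff, Set.indicator_apply,
    Set.mem_Icc, Pi.one_apply, pow_zero, one_mul]
  refine if_congr ⟨fun h => ⟨by linarith, lt_of_le_of_ne (by linarith) hx⟩,
    fun h => ⟨by linarith, by linarith⟩⟩ rfl rfl

/-- The two conventions differ only at the midpoint and the right endpoint of the support. -/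
theorem haar_mother_ae (l : Index) (j : ℕ) (h : l.level = j) :
    haar l =ᵐ[volume] mother j l.shift := by
  have h2 : (2 : ℝ) ^ j ≠ 0 := by positivity
  have e1 : ∀ᵐ x : ℝ, x ≠ ((l.shift : ℝ) + 1) / 2 ^ j := compl_mem_ae_iff.2 (measure_singleton _)
  have e2 : ∀ᵐ x : ℝ, x ≠ ((l.shift : ℝ) + 1 / 2) / 2 ^ j :=
    compl_mem_ae_iff.2 (measure_singleton _)
  filter_upwards [e1, e2] with x hx1 hx2
  classical
  have hn : ¬ ((j : ℤ) = -1) := by omega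
  simp only [haar, h, if_neg hn, mother, zpow_natCast, Int.cast_natCast]
  congr 1
  rw [ne_eq, eq_div_iff h2, mul_comm] at hx1 hx2
  simp only [haarMother, cell_apply, dyad_eq_iff, Pi.sub_apply, Set.indicator_apply,
    Set.mem_Icc, Set.mem_Ioc, Pi.one_apply, pow_succ]
  push_cast
  set y := (2 : ℝ) ^ j * x
  rw [show (2 : ℝ) ^ j * 2 * x = 2 * y by simp only [y]; ring]
  congr 1
  · exact if_congr ⟨fun h => ⟨by linarith, lt_of_le_of_ne (by linarith [h.2])
        fun h' => hx2 (by linarith)⟩, fun h => ⟨by linarith, by linarith⟩⟩ rfl rfl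
  · exact if_congr ⟨fun h => ⟨by linarith, lt_of_le_of_ne (by linarith [h.2])
        fun h' => hx1 (by linarith)⟩, fun h => ⟨lt_of_le_of_ne (by linarith [h.1])
        fun h' => hx2 (by linarith), by linarith⟩⟩ rfl rfl

/-! ### Sparse perturbations of the uniform intensity -/

/-- A sum of Haar functions of level `j`. -/
def bumps (j : ℕ) (T : Finset ℤ) (x : ℝ) : ℝ := ∑ k ∈ T, mother j k x

/-- The intensity `1/2` on `[0, 1)`, perturbed by Haar functions of level `j`. -/
def intensity (ε : ℝ) (j : ℕ) (T : Finset ℤ) (x : ℝ) : ℝ := cell 0 0 x / 2 + ε * bumps j T x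

@[fun_prop]
theorem measurable_bumps (j : ℕ) (T : Finset ℤ) : Measurable (bumps j T) := by
  unfold bumps; fun_prop

@[fun_prop]
theorem measurable_intensity (ε : ℝ) (j : ℕ) (T : Finset ℤ) : Measurable (intensity ε j T) := by
  unfold intensity; fun_prop

/-- Cells of one level are disjoint, so at most one bump is active at a point and sup bounds do not
depend on the size of `T`. -/
theorem bumps_eq {j : ℕ} {T : Finset ℤ} {x : ℝ} :
    bumps j T x = if dyad j x ∈ T then mother j (dyad j x) x else 0 := by
  split_ifs with h
  · exact Finset.sum_eq_single_of_mem _ h fun k _ hk => mother_eq_zero hk.symm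
  · exact Finset.sum_eq_zero fun k hk => mother_eq_zero fun h' => h (h' ▸ hk)

theorem abs_bumps_le (j : ℕ) (T : Finset ℤ) (x : ℝ) :
    |bumps j T x| ≤ (2 : ℝ) ^ ((j : ℝ) / 2) := by
  rw [bumps_eq]
  split_ifs
  · exact abs_mother_le _ _ _
  · rw [abs_zero]; positivity

theorem bumps_eq_zero {j : ℕ} {T : Finset ℤ} (hT : T ⊆ Finset.Ico 0 (2 ^ j)) {x : ℝ}
    (hx : dyad 0 x ≠ 0) : bumps j T x = 0 := by
  rw [bumps_eq, if_neg]
  intro h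
  have h1 := Finset.mem_Ico.1 (hT h)
  refine hx ?_
  rw [dyad_eq_ediv 0 j x, zero_add]
  exact Int.ediv_eq_zero_of_lt h1.1 h1.2

theorem integrable_bumps (j : ℕ) (T : Finset ℤ) : Integrable (bumps j T) :=
  integrable_finsetSum _ fun k _ => integrable_mother j k

theorem integrable_intensity (ε : ℝ) (j : ℕ) (T : Finset ℤ) : Integrable (intensity ε j T) :=
  ((integrable_cell 0 0).div_const 2).add ((integrable_bumps j T).const_mul ε)

/-- The bound 1/2 matches the base level of the intensity: this is what keeps the perturbed
intensity nonnegative. -/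
theorem abs_eps_mul_le {ε b : ℝ} {j : ℕ} (hε : ε ^ 2 * 2 ^ j ≤ 1 / 4)
    (hb : |b| ≤ (2 : ℝ) ^ ((j : ℝ) / 2)) : |ε * b| ≤ 1 / 2 := by
  refine abs_le_of_sq_le_sq ?_ (by norm_num)
  have : b ^ 2 ≤ 2 ^ j := by
    rw [← amplitude_sq]
    exact sq_le_sq.2 (hb.trans (le_abs_self _))
  rw [mul_pow]
  nlinarith [mul_le_mul_of_nonneg_left this (sq_nonneg ε)]

theorem intensity_nonneg {ε : ℝ} {j : ℕ} {T : Finset ℤ} (hT : T ⊆ Finset.Ico 0 (2 ^ j))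
    (hε : ε ^ 2 * 2 ^ j ≤ 1 / 4) (x : ℝ) : 0 ≤ intensity ε j T x := by
  have h := abs_le.1 (abs_eps_mul_le hε (abs_bumps_le j T x))
  rw [intensity, cell_apply]
  split_ifs with hx
  · linarith
  · rw [bumps_eq_zero hT hx]; simp

theorem abs_intensity_le {ε : ℝ} {j : ℕ} {T : Finset ℤ} (hT : T ⊆ Finset.Ico 0 (2 ^ j))
    (hε : ε ^ 2 * 2 ^ j ≤ 1 / 4) (x : ℝ) : |intensity ε j T x| ≤ cell 0 0 x := by
  have h := abs_le.1 (abs_eps_mul_le hε (abs_bumps_le j T x))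
  rw [abs_le, intensity, cell_apply]
  split_ifs with hx
  · constructor <;> linarith
  · rw [bumps_eq_zero hT hx]; simp

/-- The function is bounded by 1 on a set of measure one and vanishes outside, which handles all
exponents together. -/
theorem eLpNorm_intensity_le {ε : ℝ} {j : ℕ} {T : Finset ℤ} (hT : T ⊆ Finset.Ico 0 (2 ^ j))
    (hε : ε ^ 2 * 2 ^ j ≤ 1 / 4) (p : ℝ≥0∞) : eLpNorm (intensity ε j T) p volume ≤ 1 := by
  have hs := measurableSet_dyad_eq 0 0
  have hind : {x | dyad 0 x = 0}.indicator (intensity ε j T) = intensity ε j T := by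
    ext x
    by_cases hx : dyad 0 x = 0
    · simp [hx]
    · have := abs_intensity_le hT hε x
      rw [cell_apply, if_neg hx] at this
      simp [hx, abs_nonpos_iff.1 this]
  rw [← hind, eLpNorm_indicator_eq_eLpNorm_restrict hs]
  refine (eLpNorm_le_of_ae_bound (C := 1) (Eventually.of_forall fun x => ?_)).trans ?_
  · refine (abs_intensity_le hT hε x).trans ?_
    rw [cell_apply]
    split_ifs <;> simp
  · simp [volume_dyad_eq]

theorem intensity_mem_lebesgueBall {ε : ℝ} {j : ℕ} {T : Finset ℤ}
    (hT : T ⊆ Finset.Ico 0 (2 ^ j)) (hε : ε ^ 2 * 2 ^ j ≤ 1 / 4) {R : ℝ} (hR : 1 ≤ R) :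
    intensity ε j T ∈ lebesgueBall R := by
  have h : ∀ p, eLpNorm (intensity ε j T) p volume ≤ ENNReal.ofReal R := fun p =>
    (eLpNorm_intensity_le hT hε p).trans (by simpa using hR)
  exact ⟨(measurable_intensity ε j T).aestronglyMeasurable, h 1, h 2, h ⊤⟩

theorem memLp_intensity {ε : ℝ} {j : ℕ} {T : Finset ℤ}
    (hT : T ⊆ Finset.Ico 0 (2 ^ j)) (hε : ε ^ 2 * 2 ^ j ≤ 1 / 4) :
    MemLp (intensity ε j T) 2 volume :=
  ⟨(measurable_intensity ε j T).aestronglyMeasurable,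
    (eLpNorm_intensity_le hT hε 2).trans_lt ENNReal.one_lt_top⟩

theorem integrable_mul_cell {F : ℝ → ℝ} (hF : Integrable F volume) (i : ℕ) (q : ℤ) :
    Integrable (fun x => F x * cell i q x) := by
  refine hF.mul_bdd (c := 1) (measurable_cell i q).aestronglyMeasurable (Eventually.of_forall fun x => ?_)
  rw [cell_apply]
  split_ifs <;> simp

theorem integrable_mul_mother {F : ℝ → ℝ} (hF : Integrable F volume) (i : ℕ) (q : ℤ) :
    Integrable (fun x => F x * mother i q x) :=
  hF.mul_bdd (measurable_mother i q).aestronglyMeasurable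
    (Eventually.of_forall fun x => abs_mother_le i q x)

theorem integral_mul_intensity {F : ℝ → ℝ} (hF : Integrable F) (ε : ℝ) (j : ℕ) (T : Finset ℤ) :
    ∫ x, F x * intensity ε j T x
      = (∫ x, F x * cell 0 0 x) / 2 + ε * ∑ k ∈ T, ∫ x, F x * mother j k x := by
  have h : ∀ x, F x * intensity ε j T x
      = F x * cell 0 0 x / 2 + ε * ∑ k ∈ T, F x * mother j k x := fun x => by
    rw [intensity, bumps, ← Finset.mul_sum]; ring
  simp_rw [h]
  rw [integral_add ((integrable_mul_cell hF 0 0).div_const 2)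
      ((integrable_finsetSum _ fun k _ => integrable_mul_mother hF j k).const_mul ε),
    integral_div, integral_const_mul, integral_finsetSum _ fun k _ => integrable_mul_mother hF j k]

theorem integral_cell_mul_cell {i : ℕ} (q : ℤ) :
    ∫ x, cell i q x * cell 0 0 x = if q / 2 ^ i = 0 then 1 / 2 ^ i else 0 := by
  have h : ∀ x, cell i q x * cell 0 0 x = (if q / 2 ^ i = 0 then 1 else 0) * cell i q x := by
    intro x
    simp only [cell_apply, dyad_eq_ediv 0 i x, zero_add]
    by_cases hx : dyad i x = q <;> simp [hx]
  simp_rw [h, integral_const_mul, integral_cell]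
  split_ifs <;> simp

/-- The index `(j, k)`. -/
def motherIndex (j : ℕ) (k : ℤ) : Index := ⟨(j, k), by simp only; omega⟩

/-- The index `(-1, 0)`. -/
def fatherIndex : Index := ⟨(-1, 0), le_rfl⟩

/-! ### Haar coefficients of the perturbed intensities and membership in the classes. -/

theorem coeff_intensity (ε : ℝ) (j : ℕ) (T : Finset ℤ) (l : Index) :
    coeff (intensity ε j T) l = if l = fatherIndex then 1 / 2 else
      if l.level = j ∧ l.shift ∈ T then ε else 0 := by
  rw [coeff]
  obtain ⟨⟨i, q⟩, hi⟩ := l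
  simp only at hi
  by_cases h1 : i = -1
  · subst h1
    have hae := haar_father_ae ⟨(-1, q), hi⟩ rfl
    refine (integral_congr_ae (hae.mono fun x hx => congrArg (· * _) hx)).trans ?_
    refine (integral_mul_intensity (integrable_cell 0 q) ε j T).trans ?_
    simp_rw [integral_cell_mul_cell, integral_cell_mul_mother (Nat.zero_le j)]
    have hn : ¬ ((-1 : ℤ) = j) := by omega
    simp [fatherIndex, Index.level, hn]
    split_ifs <;> simp
  · obtain ⟨i, rfl⟩ : ∃ i' : ℕ, i = i' := ⟨i.toNat, by omega⟩
    have hae := haar_mother_ae ⟨(i, q), hi⟩ i rfl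
    refine (integral_congr_ae (hae.mono fun x hx => congrArg (· * _) hx)).trans ?_
    refine (integral_mul_intensity (integrable_mother i q) ε j T).trans ?_
    simp_rw [mul_comm _ (cell 0 0 _), integral_cell_mul_mother (Nat.zero_le i),
      integral_mother_mul_mother]
    have hn : ¬ ((i : ℤ) = -1) := by omega
    simp only [Index.level, Index.shift, fatherIndex, Subtype.mk.injEq, Prod.mk.injEq, hn,
      false_and, if_false, Nat.cast_inj]
    by_cases hij : i = j <;> by_cases hq : q ∈ T <;> simp [hij, hq]

theorem sigma_intensity_father (ε : ℝ) (j : ℕ) (T : Finset ℤ) :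
    sigma (intensity ε j T) fatherIndex = √(1 / 2) := by
  rw [sigma]
  congr 1
  have hae := haar_father_ae fatherIndex rfl
  refine (integral_congr_ae (hae.mono fun x hx => congrArg (· ^ 2 * _) hx)).trans ?_
  have h : ∀ x, cell 0 0 x ^ 2 = cell 0 0 x := fun x => by
    rw [cell_apply]; split_ifs <;> simp
  simp only [fatherIndex, Index.shift, h]
  rw [integral_mul_intensity (integrable_cell 0 0)]
  simp_rw [integral_cell_mul_cell, integral_cell_mul_mother (Nat.zero_le j)]
  simp

/-- The square of a Haar function is a multiple of its cell, which is orthogonal to bumps of the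
same level; only the uniform part contributes to σ². -/
theorem sigma_intensity_mother (ε : ℝ) {j : ℕ} {T : Finset ℤ} (l : Index) (hl : l.level = j)
    (h0 : l.shift ∈ Finset.Ico 0 (2 ^ j)) :
    sigma (intensity ε j T) l = √(1 / 2) := by
  rw [sigma]
  congr 1
  have hae := haar_mother_ae l j hl
  refine (integral_congr_ae (hae.mono fun x hx => congrArg (· ^ 2 * _) hx)).trans ?_
  simp only [mother_sq, mul_assoc]
  rw [integral_const_mul, integral_mul_intensity (integrable_cell _ _)]
  simp_rw [integral_cell_mul_cell, integral_cell_mul_mother le_rfl]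
  rw [Finset.mem_Ico] at h0
  simp [Int.ediv_eq_zero_of_lt h0.1 h0.2]
  field_simp

theorem tsum_subtype_le {S : Set Index} {F : Index → ℝ≥0∞} {l₀ : Index} {j : ℕ} {T : Finset ℤ}
    {a b : ℝ≥0∞} (h : ∀ l ∈ S, F l ≤ if l = l₀ then a else
      if l.level = j ∧ l.shift ∈ T then b else 0) :
    ∑' l : S, F l ≤ a + T.card * b := by
  let G : Index → ℝ≥0∞ := fun l =>
    (if l = l₀ then a else 0) + ∑ k ∈ T, if l = motherIndex j k then b else 0
  have h' : ∀ l : S, F l ≤ G l := by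
    intro l
    refine (h l l.2).trans ?_
    simp only [G]
    split_ifs with h1 h2
    · simp [h1]
    · have : (l : Index) = motherIndex j l.1.shift := Subtype.ext (Prod.ext h2.1 rfl)
      refine le_add_left ?_
      refine le_trans ?_ (Finset.single_le_sum (fun _ _ => zero_le) h2.2)
      rw [if_pos this]
    · exact zero_le
  refine (ENNReal.tsum_le_tsum h').trans ?_
  refine (ENNReal.tsum_comp_le_tsum_of_injective Subtype.val_injective G).trans ?_
  simp only [G]
  rw [ENNReal.tsum_add, tsum_ite_eq, Summable.tsum_finsetSum fun _ _ => ENNReal.summable]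
  simp [tsum_ite_eq]

/-- The left side decreases in `t`, so the worst threshold is t = β/σ with σ² = 1/2. -/
theorem rpow_mul_sq_le {s t β : ℝ} (hs : 0 < s) (hβ : 0 < β)
    (h : β ≤ √(1 / 2) * t) : t ^ (-4 * s) * β ^ 2 ≤ β ^ (2 - 4 * s) * (1 / 2) ^ (2 * s) := by
  have h2 : (0 : ℝ) < √(1 / 2) := by positivity
  have h1 : β / √(1 / 2) ≤ t := by rwa [div_le_iff₀ h2, mul_comm]
  calc t ^ (-4 * s) * β ^ 2 ≤ (β / √(1 / 2)) ^ (-4 * s) * β ^ 2 := by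
        refine mul_le_mul_of_nonneg_right ?_ (sq_nonneg β)
        exact Real.rpow_le_rpow_of_nonpos (by positivity) h1 (by linarith)
    _ = β ^ (2 - 4 * s) * (1 / 2) ^ (2 * s) := by
        rw [Real.div_rpow hβ.le h2.le, Real.sqrt_eq_rpow, ← Real.rpow_mul (by norm_num),
          show 1 / 2 * (-4 * s) = -(2 * s) by ring, Real.rpow_neg (by norm_num), div_inv_eq_mul,
          sub_eq_add_neg, Real.rpow_add hβ, ← Real.rpow_natCast β 2]
        push_cast
        ring_nf

theorem intensity_mem_weakBesovBall {ε s R : ℝ} {j : ℕ} {T : Finset ℤ}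
    (hT : T ⊆ Finset.Ico 0 (2 ^ j)) (hε : ε ^ 2 * 2 ^ j ≤ 1 / 4) (hε0 : 0 < ε) (hs : 0 < s)
    (hs1 : s < 1 / 2) (h : 1 / 2 + T.card * ε ^ (2 - 4 * s) ≤ R ^ (2 - 4 * s)) :
    intensity ε j T ∈ weakBesovBall s R := by
  refine ⟨memLp_intensity hT hε, iSup₂_le fun t ht => ?_⟩
  rw [← ENNReal.tsum_mul_left]
  -- Father term: the exponents add up to 2 - 2s, which is at least 1.
  have hf : ((1 : ℝ) / 2) ^ (2 - 4 * s) * (1 / 2) ^ (2 * s) ≤ 1 / 2 := by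
    rw [← Real.rpow_add (by norm_num)]
    exact (Real.rpow_le_rpow_of_exponent_ge (by norm_num) (by norm_num)
      (show (1 : ℝ) ≤ _ by linarith)).trans_eq (Real.rpow_one _)
  have hm : ε ^ (2 - 4 * s) * (1 / 2) ^ (2 * s) ≤ ε ^ (2 - 4 * s) :=
    mul_le_of_le_one_right (by positivity) (Real.rpow_le_one (by norm_num) (by norm_num)
      (by linarith))
  refine (tsum_subtype_le (l₀ := fatherIndex) (j := j) (T := T) (a := ENNReal.ofReal (1 / 2))
    (S := {l | |coeff (intensity ε j T) l| ≤ sigma (intensity ε j T) l * t})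
    (F := fun l => ENNReal.ofReal (t ^ (-4 * s)) *
      ENNReal.ofReal (coeff (intensity ε j T) l ^ 2))
    (b := ENNReal.ofReal (ε ^ (2 - 4 * s))) fun l hl => ?_).trans ?_
  · simp only [Set.mem_ofPred_eq] at hl
    rw [← ENNReal.ofReal_mul (by positivity)]
    rw [coeff_intensity] at hl ⊢
    split_ifs at hl ⊢ with h1 h2
    · rw [h1, sigma_intensity_father, abs_of_pos (by norm_num)] at hl
      exact ENNReal.ofReal_le_ofReal ((rpow_mul_sq_le hs (by norm_num) hl).trans hf)
    · rw [sigma_intensity_mother ε l h2.1 (hT h2.2), abs_of_pos hε0] at hl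
      exact ENNReal.ofReal_le_ofReal ((rpow_mul_sq_le hs hε0 hl).trans hm)
    · simp
  · rw [← ENNReal.ofReal_natCast, ← ENNReal.ofReal_mul (by positivity),
      ← ENNReal.ofReal_add (by positivity) (by positivity)]
    exact ENNReal.ofReal_le_ofReal h

/-- A level-`j` coefficient enters the tail at `n` only if j exceeds `maxLevel n`; then n / log n ≤
2^j, so its weight is at most (2^j)^(2s). The father never enters, because `maxLevel n` is
nonnegative. -/
theorem intensity_mem_tailBall {ε s R : ℝ} {j : ℕ} {T : Finset ℤ}
    (hT : T ⊆ Finset.Ico 0 (2 ^ j)) (hε : ε ^ 2 * 2 ^ j ≤ 1 / 4) (hs : 0 < s)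
    (h : T.card * (((2 : ℝ) ^ j) ^ (2 * s) * ε ^ 2) ≤ R ^ 2) :
    intensity ε j T ∈ tailBall levelSet s R := by
  refine ⟨memLp_intensity hT hε, iSup₂_le fun n hn => ?_⟩
  rw [← ENNReal.tsum_mul_left]
  have hlog : 0 < Real.log n := Real.log_pos (by exact_mod_cast hn)
  have hn0 : (0 : ℝ) < n := by positivity
  have hone : (1 : ℝ) ≤ n / Real.log n := by
    rw [le_div_iff₀ hlog, one_mul]
    exact (Real.log_le_sub_one_of_pos hn0).trans (by linarith)
  have hlev : 0 ≤ maxLevel n := by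
    rw [maxLevel, ← Int.zpow_le_iff_le_log one_lt_two (by linarith)]
    simpa using hone
  refine (tsum_subtype_le (l₀ := fatherIndex) (j := j) (T := T) (a := 0)
    (S := {l | l ∉ levelSet n})
    (F := fun l => ENNReal.ofReal ((Real.log n / n) ^ (-2 * s)) *
      ENNReal.ofReal (coeff (intensity ε j T) l ^ 2))
    (b := ENNReal.ofReal (((2 : ℝ) ^ j) ^ (2 * s) * ε ^ 2)) fun l hl => ?_).trans ?_
  · simp only [Set.mem_ofPred_eq, levelSet, not_le] at hl
    rw [coeff_intensity]
    split_ifs with h1 h2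
    · exfalso
      rw [h1] at hl
      simp only [fatherIndex, Index.level] at hl
      omega
    · rw [← ENNReal.ofReal_mul (by positivity)]
      refine ENNReal.ofReal_le_ofReal ?_
      gcongr
      rw [h2.1] at hl
      have hlt : (n : ℝ) / Real.log n ≤ 2 ^ j := by
        refine (maxLevel_spec n hn).2.le.trans ?_
        rw [← zpow_natCast]
        exact zpow_le_zpow_right₀ one_le_two hl
      rw [show -2 * s = -(2 * s) by ring, Real.rpow_neg (by positivity),
        ← Real.inv_rpow (by positivity), inv_div]
      exact Real.rpow_le_rpow (by positivity) hlt (by positivity)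
    · simp
  · rw [zero_add, ← ENNReal.ofReal_natCast, ← ENNReal.ofReal_mul (by positivity)]
    exact ENNReal.ofReal_le_ofReal h

/-! ### The Poisson models of the perturbed intensities -/

/-- The uniform distribution on `[0, 1)`. -/
def unif : Measure ℝ := volume.restrict {x | dyad 0 x = 0}

instance : IsProbabilityMeasure unif :=
  ⟨by rw [unif, Measure.restrict_apply_univ, volume_dyad_eq]; simp⟩

instance : NullSingletonClass unif := by unfold unif; infer_instance

theorem integral_unif (h : ℝ → ℝ) : ∫ x, h x ∂unif = ∫ x, cell 0 0 x * h x := by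
  rw [unif, ← integral_indicator (measurableSet_dyad_eq 0 0)]
  congr 1 with x
  by_cases hx : dyad 0 x = 0 <;> simp [cell_apply, hx]

/-- The density of a point of the process of intensity `n * intensity ε j T`. -/
def pointDensity (ε : ℝ) (j : ℕ) (T : Finset ℤ) (x : ℝ) : ℝ := 1 + 2 * ε * bumps j T x

@[fun_prop]
theorem measurable_pointDensity (ε : ℝ) (j : ℕ) (T : Finset ℤ) :
    Measurable (pointDensity ε j T) := by
  unfold pointDensity; fun_prop

theorem pointDensity_nonneg {ε : ℝ} {j : ℕ} (hε : ε ^ 2 * 2 ^ j ≤ 1 / 4) (T : Finset ℤ) (x : ℝ) :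
    0 ≤ pointDensity ε j T x := by
  have h := abs_le.1 (abs_eps_mul_le hε (abs_bumps_le j T x))
  rw [pointDensity]
  linarith

theorem integrable_unif_bumps (j : ℕ) (T : Finset ℤ) : Integrable (bumps j T) unif :=
  (integrable_bumps j T).restrict

theorem integrable_pointDensity (ε : ℝ) (j : ℕ) (T : Finset ℤ) :
    Integrable (pointDensity ε j T) unif :=
  (integrable_const 1).add ((integrable_unif_bumps j T).const_mul _)

theorem integral_unif_mother (j : ℕ) (k : ℤ) : ∫ x, mother j k x ∂unif = 0 := by
  rw [integral_unif, integral_cell_mul_mother (Nat.zero_le j)]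

theorem integral_pointDensity (ε : ℝ) (j : ℕ) (T : Finset ℤ) :
    ∫ x, pointDensity ε j T x ∂unif = 1 := by
  have hb : ∫ x, bumps j T x ∂unif = 0 := by
    simp only [bumps]
    have hm : ∀ k, Integrable (mother j k) unif := fun k => (integrable_mother j k).restrict
    rw [integral_finsetSum _ fun k _ => hm k]
    simp [integral_unif_mother]
  simp only [pointDensity]
  rw [integral_add (integrable_const 1) ((integrable_unif_bumps j T).const_mul _),
    integral_const_mul, hb]
  simp

theorem intensity_eq_indicator {ε : ℝ} {j : ℕ} {T : Finset ℤ} (hT : T ⊆ Finset.Ico 0 (2 ^ j)) :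
    intensity ε j T = {x | dyad 0 x = 0}.indicator fun x => pointDensity ε j T x / 2 := by
  ext x
  by_cases hx : dyad 0 x = 0
  · simp [intensity, pointDensity, cell_apply, hx]; ring
  · simp [intensity, cell_apply, hx, bumps_eq_zero hT hx]

/-- The law of the Poisson process with mean measure `n * intensity ε j T`. -/
def modelLaw (n : ℕ) (ε : ℝ) (j : ℕ) (T : Finset ℤ) : Measure Config :=
  (tiltedLaw (n / 2) unif (pointDensity ε j T)).map toConfig

/-- Bumps have mean zero, so every perturbed intensity has mass 1/2. All models therefore share the
Poisson(n/2) number of points and differ only in the density of a point. -/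
theorem isPoissonModel_modelLaw (n : ℕ) {ε : ℝ} {j : ℕ} {T : Finset ℤ}
    (hT : T ⊆ Finset.Ico 0 (2 ^ j)) (hε : ε ^ 2 * 2 ^ j ≤ 1 / 4) :
    IsPoissonModel n (intensity ε j T) (modelLaw n ε j T) := by
  refine ⟨Eventually.of_forall (intensity_nonneg hT hε), integrable_intensity ε j T,
    isPoissonProcess_map_toConfig (measurable_pointDensity ε j T) (pointDensity_nonneg hε T)
      (integrable_pointDensity ε j T) (integral_pointDensity ε j T) fun A hA => ?_⟩
  rw [withDensity_apply _ hA, ← ofReal_integral_eq_lintegral_ofReal]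
  · congr 1
    rw [integral_const_mul, intensity_eq_indicator hT,
      setIntegral_indicator (measurableSet_dyad_eq 0 0), unif, Measure.restrict_restrict hA,
      integral_div]
    push_cast
    ring
  · exact ((integrable_intensity ε j T).const_mul _).restrict
  · exact Eventually.of_forall fun x =>
      mul_nonneg (Nat.cast_nonneg n) (intensity_nonneg hT hε x)

/-! ### Likelihood ratios -/

/-- The likelihood of the perturbed model with respect to the uniform one. -/
def likelihood (ε : ℝ) (j : ℕ) (T : Finset ℤ) : Sample → ℝ≥0∞ :=
  sampleProd fun x => ENNReal.ofReal (pointDensity ε j T x)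

@[fun_prop]
theorem measurable_likelihood (ε : ℝ) (j : ℕ) (T : Finset ℤ) : Measurable (likelihood ε j T) :=
  measurable_sampleProd (by fun_prop)

theorem lintegral_likelihood (r : NNReal) {ε : ℝ} {j : ℕ} (hε : ε ^ 2 * 2 ^ j ≤ 1 / 4)
    (T : Finset ℤ) : ∫⁻ ω, likelihood ε j T ω ∂(sampleLaw r unif) = 1 := by
  rw [likelihood, lintegral_sampleProd (by fun_prop) zero_le_one]
  · simp
  · rw [← ofReal_integral_eq_lintegral_ofReal (integrable_pointDensity ε j T)
      (Eventually.of_forall (pointDensity_nonneg hε T)), integral_pointDensity]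

theorem pointDensity_mul_mother {ε : ℝ} {j : ℕ} {T : Finset ℤ} {k : ℤ} (hk : k ∉ T) (x : ℝ) :
    pointDensity ε j T x * mother j k x = mother j k x := by
  by_cases hx : dyad j x = k
  · rw [pointDensity, bumps_eq, if_neg (by rwa [hx])]; ring
  · rw [mother_eq_zero hx, mul_zero]

theorem pointDensity_singleton (ε : ℝ) (j : ℕ) (k : ℤ) (x : ℝ) :
    pointDensity ε j {k} x = 1 + 2 * ε * mother j k x := by
  rw [pointDensity, bumps, Finset.sum_singleton]

/-- Disjoint supports kill the cross term in (1 + a)(1 + b), so each new bump multiplies the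
likelihood by its own factor. -/
theorem pointDensity_insert {ε : ℝ} {j : ℕ} {T : Finset ℤ} {k : ℤ} (hk : k ∉ T) (x : ℝ) :
    pointDensity ε j (insert k T) x = pointDensity ε j T x * pointDensity ε j {k} x := by
  have h := pointDensity_mul_mother (ε := ε) (j := j) hk x
  rw [pointDensity_singleton, mul_add, mul_left_comm, h, pointDensity, pointDensity, bumps,
    Finset.sum_insert hk, ← bumps]
  ring

theorem likelihood_insert {ε : ℝ} {j : ℕ} (hε : ε ^ 2 * 2 ^ j ≤ 1 / 4) {T : Finset ℤ} {k : ℤ}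
    (hk : k ∉ T) (ω : Sample) :
    likelihood ε j (insert k T) ω = likelihood ε j T ω * likelihood ε j {k} ω := by
  rw [likelihood, likelihood, likelihood, ← sampleProd_mul]
  congr 1 with x
  rw [pointDensity_insert hk, ENNReal.ofReal_mul (pointDensity_nonneg hε T x)]

/-- Under the model with bumps `T`, the likelihood ratio of one more bump has this second moment:
the linear term has mean zero and the square contributes 4ε². The answer does not depend on `T`. -/
theorem lintegral_likelihood_mul_sq (r : NNReal) {ε : ℝ} {j : ℕ} (hε : ε ^ 2 * 2 ^ j ≤ 1 / 4)
    {T : Finset ℤ} {k : ℤ} (hk : k ∉ T) (hk0 : k ∈ Finset.Ico 0 (2 ^ j)) :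
    ∫⁻ ω, likelihood ε j T ω * likelihood ε j {k} ω ^ 2 ∂(sampleLaw r unif)
      = ENNReal.ofReal (Real.exp (r * (4 * ε ^ 2))) := by
  have hprod : ∀ x, pointDensity ε j T x * pointDensity ε j {k} x ^ 2
      = pointDensity ε j T x + 4 * ε * mother j k x + 4 * ε ^ 2 * mother j k x ^ 2 := fun x => by
    have h := pointDensity_mul_mother (ε := ε) (j := j) hk x
    rw [pointDensity_singleton]
    linear_combination (4 * ε + 4 * ε ^ 2 * mother j k x) * h
  have hsq : Integrable (fun x => mother j k x ^ 2) unif := by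
    simp only [mother_sq]
    exact ((integrable_cell j k).const_mul _).restrict
  have hm : Integrable (mother j k) unif := (integrable_mother j k).restrict
  have hsq1 : ∫ x, mother j k x ^ 2 ∂unif = 1 := by
    rw [Finset.mem_Ico] at hk0
    simp_rw [integral_unif, mother_sq, mul_left_comm (cell 0 0 _), integral_const_mul,
      mul_comm (cell 0 0 _), integral_cell_mul_cell]
    rw [if_pos (Int.ediv_eq_zero_of_lt hk0.1 hk0.2)]
    field_simp
  have hG : ∀ ω, likelihood ε j T ω * likelihood ε j {k} ω ^ 2 = sampleProd (fun x =>
      ENNReal.ofReal (pointDensity ε j T x * pointDensity ε j {k} x ^ 2)) ω := fun ω => by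
    rw [likelihood, likelihood, sq, ← sampleProd_mul, ← sampleProd_mul]
    congr 1 with x
    rw [ENNReal.ofReal_mul (pointDensity_nonneg hε T x), sq,
      ENNReal.ofReal_mul (pointDensity_nonneg hε _ x)]
  simp_rw [hG]
  rw [lintegral_sampleProd (g := 1 + 4 * ε ^ 2) (by fun_prop) (by positivity), add_sub_cancel_left]
  have hadd : Integrable (fun x => pointDensity ε j T x + 4 * ε * mother j k x) unif :=
    (integrable_pointDensity ε j T).add (hm.const_mul _)
  have hint : Integrable (fun x => pointDensity ε j T x * pointDensity ε j {k} x ^ 2) unif := by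
    simp_rw [hprod]
    exact hadd.add (hsq.const_mul _)
  rw [← ofReal_integral_eq_lintegral_ofReal hint
    (Eventually.of_forall fun x => mul_nonneg (pointDensity_nonneg hε T x) (sq_nonneg _))]
  congr 1
  simp_rw [hprod]
  rw [integral_add hadd (hsq.const_mul _),
    integral_add (integrable_pointDensity ε j T) (hm.const_mul _), integral_const_mul,
    integral_const_mul, integral_unif_mother, hsq1, integral_pointDensity]
  ring

/-! ### The risk on a block of cells -/

/-- The quadratic loss restricted to the dyadic cells of level `j` with index in `D`. -/
def blockLoss (fhat : Config → ℝ → ℝ) (ε : ℝ) (j : ℕ) (T D : Finset ℤ) (S : Config) : ℝ≥0∞ :=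
  ∫⁻ x in {x | dyad j x ∈ D}, ENNReal.ofReal ((fhat S x - intensity ε j T x) ^ 2)

theorem measurableSet_dyad_mem (j : ℕ) (D : Finset ℤ) : MeasurableSet {x | dyad j x ∈ D} :=
  measurable_dyad j (Finset.measurableSet D)

theorem measurable_blockLoss {fhat : Config → ℝ → ℝ} (hf : Measurable (Function.uncurry fhat))
    (ε : ℝ) (j : ℕ) (T D : Finset ℤ) : Measurable (blockLoss fhat ε j T D) := by
  refine Measurable.lintegral_prod_right'
    (f := fun p : Config × ℝ => ENNReal.ofReal ((fhat p.1 p.2 - intensity ε j T p.2) ^ 2)) ?_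
  have : Measurable fun p : Config × ℝ => fhat p.1 p.2 := hf
  fun_prop

/-- On the cell `k` the two intensities differ by exactly one bump, of squared norm ε², and a² + b²
≥ (a - b)²/2. Hence at most one candidate position can have loss below ε²/4. -/
theorem le_blockLoss_add {fhat : Config → ℝ → ℝ} (hf : Measurable (Function.uncurry fhat))
    (ε : ℝ) (j : ℕ) {T D : Finset ℤ} {k k' : ℤ} (hk : k ∈ D) (hne : k ≠ k') (hkT : k ∉ T)
    (S : Config) :
    ENNReal.ofReal (ε ^ 2 / 2)
      ≤ blockLoss fhat ε j (insert k T) D S + blockLoss fhat ε j (insert k' T) D S := by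
  have hfS : Measurable (fhat S) := hf.comp measurable_prodMk_left
  rw [blockLoss, blockLoss, ← lintegral_add_left (by fun_prop)]
  have hsub : {x | dyad j x = k} ⊆ {x | dyad j x ∈ D} := fun x hx => by
    simp only [Set.mem_ofPred_eq] at hx ⊢
    rwa [hx]
  refine le_trans ?_ (lintegral_mono_set hsub)
  have hle : ∫⁻ x in {x | dyad j x = k}, ENNReal.ofReal (ε ^ 2 / 2 * 2 ^ j)
      = ENNReal.ofReal (ε ^ 2 / 2) := by
    rw [setLIntegral_const, volume_dyad_eq, ← ENNReal.ofReal_mul (by positivity)]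
    congr 1
    field_simp
  rw [← hle]
  refine setLIntegral_mono (by fun_prop) fun x hx => ?_
  rw [← ENNReal.ofReal_add (sq_nonneg _) (sq_nonneg _)]
  refine ENNReal.ofReal_le_ofReal ?_
  simp only [Set.mem_ofPred_eq] at hx
  have h1 : intensity ε j (insert k T) x - intensity ε j (insert k' T) x = ε * mother j k x := by
    rw [intensity, intensity, bumps_eq, bumps_eq, if_pos (by simp [hx]), if_neg, hx]
    · ring
    · rw [hx, Finset.mem_insert, not_or]
      exact ⟨hne, hkT⟩
  have h2 : mother j k x ^ 2 = 2 ^ j := by rw [mother_sq, cell_apply, if_pos hx, mul_one]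
  have h3 : (intensity ε j (insert k T) x - intensity ε j (insert k' T) x) ^ 2 = ε ^ 2 * 2 ^ j := by
    rw [h1, mul_pow, h2]
  nlinarith [sq_nonneg ((fhat S x - intensity ε j (insert k T) x)
    + (fhat S x - intensity ε j (insert k' T) x))]

/-- At most one index has loss below `δ`. For every other index `δ` is at most the loss; for the
exceptional one the weight is bounded by τ + r²/τ, with a sum of squares that does not need to know
which index it is. -/
theorem sum_mul_le_of_separated {ι : Type*} (D : Finset ι) (r loss : ι → ℝ≥0∞) {δ τ : ℝ≥0∞}
    (hτ0 : τ ≠ 0) (hτ : τ ≠ ⊤)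
    (h : ∀ k ∈ D, ∀ k' ∈ D, loss k < δ → loss k' < δ → k = k') :
    δ * ∑ k ∈ D, r k ≤ ∑ k ∈ D, r k * loss k + δ * (τ + ∑ k ∈ D, r k ^ 2 / τ) := by
  classical
  rw [Finset.mul_sum]
  by_cases hex : ∃ k ∈ D, loss k < δ
  · obtain ⟨k, hk, hlt⟩ := hex
    rw [← Finset.sum_erase_add _ _ hk]
    refine add_le_add ?_ ?_
    · refine (Finset.sum_le_sum fun k' hk' => ?_).trans
        (Finset.sum_le_sum_of_subset (Finset.erase_subset k D))
      rw [mul_comm]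
      refine mul_le_mul_right (not_lt.1 fun hlt' => ?_) _
      exact Finset.ne_of_mem_erase hk' (h _ (Finset.mem_of_mem_erase hk') _ hk hlt' hlt)
    · refine mul_le_mul_right ?_ _
      rcases le_total (r k) τ with hr | hr
      · exact hr.trans le_self_add
      · refine le_trans ?_ (le_add_left (Finset.single_le_sum
          (f := fun k => r k ^ 2 / τ) (fun _ _ => zero_le) hk))
        rw [ENNReal.le_div_iff_mul_le (Or.inl hτ0) (Or.inl hτ), sq]
        exact mul_le_mul_right hr _
  · push Not at hex
    refine (Finset.sum_le_sum fun k hk => ?_).trans le_self_add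
    rw [mul_comm]
    exact mul_le_mul_right (hex k hk) _

/-- Given the bumps `T` outside the block, integrating the separation inequality against the
likelihood of `T` bounds the Bayes risk over the position in `D`. Only second moments of likelihood
ratios enter. -/
theorem sum_lintegral_blockLoss_ge {fhat : Config → ℝ → ℝ}
    (hf : Measurable (Function.uncurry fhat)) (r : NNReal) {ε : ℝ} {j : ℕ}
    (hε : ε ^ 2 * 2 ^ j ≤ 1 / 4) {T D : Finset ℤ} (hTD : Disjoint T D)
    (hD : D ⊆ Finset.Ico 0 (2 ^ j)) (hcard : 16 * Real.exp (r * (4 * ε ^ 2)) ≤ D.card) :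
    ENNReal.ofReal (D.card * (ε ^ 2 / 8)) ≤ ∑ k ∈ D, ∫⁻ ω, likelihood ε j (insert k T) ω *
      blockLoss fhat ε j (insert k T) D (toConfig ω) ∂(sampleLaw r unif) := by
  have hnot : ∀ k ∈ D, k ∉ T := fun k hk hkT => Finset.disjoint_left.1 hTD hkT hk
  set V := Real.exp (r * (4 * ε ^ 2))
  have hV0 : 0 < V := Real.exp_pos _
  have hB : (0 : ℝ) < D.card := by linarith
  set δ := ENNReal.ofReal (ε ^ 2 / 4) with hδ
  -- With this truncation level the error is δ(|D|/4 + 4V), at most half of δ|D| because 16V ≤ |D|.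
  set τ := ENNReal.ofReal ((D.card : ℝ) / 4) with hτ
  have hτ0 : τ ≠ 0 := by rw [hτ, ne_eq, ENNReal.ofReal_eq_zero, not_le]; positivity
  have hmeasL : ∀ k, Measurable fun ω => blockLoss fhat ε j (insert k T) D (toConfig ω) :=
    fun k => (measurable_blockLoss hf ε j _ D).comp measurable_toConfig
  have hpt : ∀ ω, δ * ∑ k ∈ D, likelihood ε j T ω * likelihood ε j {k} ω ≤
      ∑ k ∈ D, likelihood ε j T ω * likelihood ε j {k} ω *
        blockLoss fhat ε j (insert k T) D (toConfig ω)
      + δ * (τ * likelihood ε j T ω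
        + ∑ k ∈ D, likelihood ε j T ω * likelihood ε j {k} ω ^ 2 * τ⁻¹) := by
    intro ω
    have h := mul_le_mul_right (sum_mul_le_of_separated D (fun k => likelihood ε j {k} ω)
      (fun k => blockLoss fhat ε j (insert k T) D (toConfig ω)) (δ := δ) hτ0 ENNReal.ofReal_ne_top
      fun k hk k' _ h1 h2 => by
        by_contra hne
        refine (le_blockLoss_add hf ε j hk hne (hnot k hk) (toConfig ω)).not_gt ?_
        refine (ENNReal.add_lt_add h1 h2).trans_eq ?_
        rw [hδ, ← ENNReal.ofReal_add (by positivity) (by positivity)]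
        congr 1
        ring) (likelihood ε j T ω)
    refine le_of_eq_of_le ?_ (h.trans_eq ?_)
    · simp only [Finset.mul_sum]
      exact Finset.sum_congr rfl fun k _ => by ring
    · simp only [mul_add, Finset.mul_sum, div_eq_mul_inv]
      congr 1
      · exact Finset.sum_congr rfl fun k _ => by ring
      · congr 1
        · ring
        · exact Finset.sum_congr rfl fun k _ => by ring
  have hint := lintegral_mono (μ := sampleLaw r unif) hpt
  have hmeas2 : ∀ k, Measurable fun ω => likelihood ε j T ω * likelihood ε j {k} ω ^ 2 * τ⁻¹ :=
    fun k => by fun_prop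
  have hmeas3 : ∀ k, Measurable fun ω => likelihood ε j T ω * likelihood ε j {k} ω *
        blockLoss fhat ε j (insert k T) D (toConfig ω) := fun k =>
    Measurable.mul (by fun_prop) (hmeasL k)
  rw [lintegral_const_mul _ (by fun_prop), lintegral_finsetSum _ fun k _ => by fun_prop,
    lintegral_add_left (Finset.measurable_fun_sum _ fun k _ => hmeas3 k),
    lintegral_finsetSum _ fun k _ => hmeas3 k, lintegral_const_mul _ (by fun_prop),
    lintegral_add_left (by fun_prop), lintegral_const_mul _ (by fun_prop),
    lintegral_finsetSum _ fun k _ => hmeas2 k, lintegral_likelihood r hε,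
    Finset.sum_congr rfl (g := fun _ => (1 : ℝ≥0∞)),
    Finset.sum_congr rfl (s₁ := D)
      (f := fun k => ∫⁻ ω, likelihood ε j T ω * likelihood ε j {k} ω ^ 2 * τ⁻¹ ∂(sampleLaw r unif))
      (g := fun _ => ENNReal.ofReal V * τ⁻¹)] at hint
  rotate_left
  · intro k hk
    rw [lintegral_mul_const _ (by fun_prop), lintegral_likelihood_mul_sq r hε (hnot k hk) (hD hk)]
  · intro k hk
    simp_rw [← likelihood_insert hε (hnot k hk)]
    exact lintegral_likelihood r hε _
  have hsum : ∑ k ∈ D, ∫⁻ ω, likelihood ε j T ω * likelihood ε j {k} ω *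
        blockLoss fhat ε j (insert k T) D (toConfig ω) ∂(sampleLaw r unif)
      = ∑ k ∈ D, ∫⁻ ω, likelihood ε j (insert k T) ω *
      blockLoss fhat ε j (insert k T) D (toConfig ω) ∂(sampleLaw r unif) :=
    Finset.sum_congr rfl fun k hk => by simp_rw [likelihood_insert hε (hnot k hk)]
  rw [hsum, Finset.sum_const, Finset.sum_const, mul_one, nsmul_eq_mul, nsmul_eq_mul, mul_one] at hint
  have hsecond : δ * (τ + D.card * (ENNReal.ofReal V * τ⁻¹))
      ≤ ENNReal.ofReal (D.card * (ε ^ 2 / 8)) := by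
    rw [hδ, hτ, ← ENNReal.ofReal_inv_of_pos (by positivity), ← ENNReal.ofReal_natCast,
      ← ENNReal.ofReal_mul hV0.le, ← ENNReal.ofReal_mul hB.le,
      ← ENNReal.ofReal_add (by positivity) (by positivity), ← ENNReal.ofReal_mul (by positivity)]
    refine ENNReal.ofReal_le_ofReal ?_
    have : (D.card : ℝ) * (V * ((D.card : ℝ) / 4)⁻¹) = 4 * V := by field_simp
    rw [this]
    nlinarith [sq_nonneg ε]
  have hfirst : δ * D.card
      = ENNReal.ofReal (D.card * (ε ^ 2 / 8)) + ENNReal.ofReal (D.card * (ε ^ 2 / 8)) := by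
    rw [hδ, ← ENNReal.ofReal_natCast, ← ENNReal.ofReal_mul (by positivity),
      ← ENNReal.ofReal_add (by positivity) (by positivity)]
    congr 1
    ring
  rw [hfirst] at hint
  exact ENNReal.le_of_add_le_add_right ENNReal.ofReal_ne_top
    (hint.trans (add_le_add le_rfl hsecond))

/-! ### Averaging over the positions of the perturbations -/

theorem risk_modelLaw (n : ℕ) (ε : ℝ) (j : ℕ) (T : Finset ℤ) {fhat : Config → ℝ → ℝ}
    (hf : Measurable (Function.uncurry fhat)) :
    risk (modelLaw n ε j T) fhat (intensity ε j T)
      = ∫⁻ ω, likelihood ε j T ω * (∫⁻ x, ENNReal.ofReal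
        ((fhat (toConfig ω) x - intensity ε j T x) ^ 2)) ∂(sampleLaw (n / 2) unif) := by
  have hnorm : ∀ S, eLpNorm (fun x => fhat S x - intensity ε j T x) 2 volume ^ 2
      = ∫⁻ x, ENNReal.ofReal ((fhat S x - intensity ε j T x) ^ 2) := fun S => by
    have h := eLpNorm_nnreal_pow_eq_lintegral (μ := (volume : Measure ℝ)) (p := 2)
      (f := fun x => fhat S x - intensity ε j T x) two_ne_zero
    norm_num at h
    rw [h]
    congr 1 with x
    rw [← ofReal_norm, ← ENNReal.ofReal_pow (norm_nonneg _), Real.norm_eq_abs, sq_abs]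
  have hm : Measurable fun S : Config =>
      ∫⁻ x, ENNReal.ofReal ((fhat S x - intensity ε j T x) ^ 2) := by
    refine Measurable.lintegral_prod_right'
      (f := fun p : Config × ℝ => ENNReal.ofReal ((fhat p.1 p.2 - intensity ε j T p.2) ^ 2)) ?_
    have : Measurable fun p : Config × ℝ => fhat p.1 p.2 := hf
    fun_prop
  simp_rw [risk, hnorm]
  rw [modelLaw, lintegral_map hm measurable_toConfig, tiltedLaw]
  exact lintegral_withDensity_eq_lintegral_mul _ (measurable_likelihood ε j T)
    (hm.comp measurable_toConfig)

theorem sum_blockLoss_le {ι : Type*} [Fintype ι] (fhat : Config → ℝ → ℝ) (ε : ℝ) (j : ℕ)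
    (T : Finset ℤ) {D : ι → Finset ℤ} (hD : Pairwise fun b b' => Disjoint (D b) (D b'))
    (S : Config) :
    ∑ b, blockLoss fhat ε j T (D b) S
      ≤ ∫⁻ x, ENNReal.ofReal ((fhat S x - intensity ε j T x) ^ 2) := by
  simp only [blockLoss]
  rw [← lintegral_biUnion_finset _ fun b _ => measurableSet_dyad_mem j (D b)]
  · exact setLIntegral_le_lintegral _ _
  · intro b _ b' _ hne
    refine Set.disjoint_left.2 fun x hx hx' => ?_
    exact Finset.disjoint_left.1 (hD hne) hx hx'

/-- Exchanging the `b`-th coordinate with the spare value is an involution on pairs; so resampling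
one coordinate preserves the uniform average. -/
theorem sum_sum_update {ι κ M : Type*} [Fintype ι] [DecidableEq ι] [Fintype κ] [AddCommMonoid M]
    [DecidableEq κ] (F : (ι → κ) → M) (b : ι) :
    ∑ K, ∑ k, F (Function.update K b k) = Fintype.card κ • ∑ K, F K := by
  have h := Fintype.sum_equiv (f := fun p : (ι → κ) × κ => F (Function.update p.1 b p.2))
    (g := fun p => F p.1)
    { toFun := fun p => (Function.update p.1 b p.2, p.1 b)
      invFun := fun p => (Function.update p.1 b p.2, p.1 b)
      left_inv := fun p => by simp
      right_inv := fun p => by simp } fun p => rfl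
  rw [Fintype.sum_prod_type, Fintype.sum_prod_type] at h
  rw [h, Finset.smul_sum]
  simp

/-- The `k`-th cell of the `b`-th block of `B` consecutive cells. -/
def blockCell {m B : ℕ} (b : Fin m) (k : Fin B) : ℤ := b * B + k

theorem blockCell_inj {m B : ℕ} {b b' : Fin m} {k k' : Fin B}
    (h : blockCell b k = blockCell b' k') : b = b' ∧ k = k' := by
  have h' : (k : ℕ) + B * b = k' + B * b' := by
    have : (b : ℤ) * B + k = b' * B + k' := h
    zify
    linarith
  have hB : 0 < B := k.pos
  have h1 := congrArg (· / B) h'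
  have h2 := congrArg (· % B) h'
  simp only [Nat.add_mul_div_left _ _ hB, Nat.div_eq_of_lt k.2, Nat.div_eq_of_lt k'.2,
    Nat.add_mul_mod_self_left, Nat.mod_eq_of_lt k.2, Nat.mod_eq_of_lt k'.2] at h1 h2
  exact ⟨Fin.ext (by omega), Fin.ext h2⟩

theorem blockCell_mem {m B j : ℕ} (h : m * B ≤ 2 ^ j) (b : Fin m) (k : Fin B) :
    blockCell b k ∈ Finset.Ico (0 : ℤ) (2 ^ j) := by
  rw [Finset.mem_Ico, blockCell]
  refine ⟨by positivity, ?_⟩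
  have : (b : ℕ) * B + k < 2 ^ j := by
    have h1 : ((b : ℕ) + 1) * B ≤ m * B := Nat.mul_le_mul_right _ b.2
    have := k.2
    nlinarith
  exact_mod_cast this

/-- One cell in each block. -/
def pickCells {m B : ℕ} (K : Fin m → Fin B) : Finset ℤ :=
  Finset.univ.image fun b => blockCell b (K b)

/-- One cell in each block other than the `b`-th. -/
def otherCells {m B : ℕ} (K : Fin m → Fin B) (b : Fin m) : Finset ℤ :=
  (Finset.univ.erase b).image fun b' => blockCell b' (K b')

/-- The cells of the `b`-th block. -/
def blockCells {m : ℕ} (B : ℕ) (b : Fin m) : Finset ℤ :=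
  Finset.univ.image fun k : Fin B => blockCell b k

theorem card_pickCells {m B : ℕ} (K : Fin m → Fin B) : (pickCells K).card = m := by
  rw [pickCells, Finset.card_image_of_injective _ fun b b' h => (blockCell_inj h).1]
  simp

theorem blockCell_injective {m B : ℕ} (b : Fin m) :
    Function.Injective fun k : Fin B => blockCell b k := fun _ _ h => (blockCell_inj h).2

theorem card_blockCells {m : ℕ} (B : ℕ) (b : Fin m) : (blockCells B b).card = B := by
  rw [blockCells, Finset.card_image_of_injective _ (blockCell_injective b)]
  simp

theorem pickCells_update {m B : ℕ} (K : Fin m → Fin B) (b : Fin m) (k : Fin B) :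
    pickCells (Function.update K b k) = insert (blockCell b k) (otherCells K b) := by
  rw [pickCells, ← Finset.insert_erase (Finset.mem_univ b), Finset.image_insert,
    Function.update_self, otherCells]
  congr 1
  refine Finset.image_congr fun b' hb' => ?_
  simp only [Function.update_of_ne (Finset.ne_of_mem_erase hb')]

theorem pickCells_subset {m B j : ℕ} (h : m * B ≤ 2 ^ j) (K : Fin m → Fin B) :
    pickCells K ⊆ Finset.Ico 0 (2 ^ j) :=
  Finset.image_subset_iff.2 fun b _ => blockCell_mem h b (K b)

theorem blockCells_subset {m B j : ℕ} (h : m * B ≤ 2 ^ j) (b : Fin m) :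
    blockCells B b ⊆ Finset.Ico 0 (2 ^ j) :=
  Finset.image_subset_iff.2 fun k _ => blockCell_mem h b k

theorem disjoint_blockCells {m B : ℕ} {b b' : Fin m} (h : b ≠ b') :
    Disjoint (blockCells B b) (blockCells B b') := by
  refine Finset.disjoint_left.2 fun x hx hx' => ?_
  simp only [blockCells, Finset.mem_image, Finset.mem_univ, true_and] at hx hx'
  obtain ⟨k, rfl⟩ := hx
  obtain ⟨k', hk'⟩ := hx'
  exact h (blockCell_inj hk').1.symm

theorem disjoint_otherCells {m B : ℕ} (K : Fin m → Fin B) (b : Fin m) :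
    Disjoint (otherCells K b) (blockCells B b) := by
  refine Finset.disjoint_left.2 fun x hx hx' => ?_
  simp only [blockCells, otherCells, Finset.mem_image, Finset.mem_univ, true_and,
    Finset.mem_erase, and_true] at hx hx'
  obtain ⟨b', hb', rfl⟩ := hx
  obtain ⟨k', hk'⟩ := hx'
  exact hb' (blockCell_inj hk').1.symm

/-- The worst risk over the perturbations of `m` among at least `m * B` cells. -/
theorem le_of_forall_risk_le {m B j n : ℕ} (hmB : m * B ≤ 2 ^ j) {ε : ℝ}
    (hε : ε ^ 2 * 2 ^ j ≤ 1 / 4) (hB : 16 * Real.exp (2 * n * ε ^ 2) ≤ B)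
    {fhat : Config → ℝ → ℝ} (hf : Measurable (Function.uncurry fhat)) {c : ℝ≥0∞}
    (hc : ∀ T ⊆ Finset.Ico (0 : ℤ) (2 ^ j), T.card = m →
      risk (modelLaw n ε j T) fhat (intensity ε j T) ≤ c) :
    ENNReal.ofReal (m * (ε ^ 2 / 8)) ≤ c := by
  have hB0 : 0 < B := by
    have := Real.exp_pos (2 * n * ε ^ 2)
    exact_mod_cast (show (0 : ℝ) < B by linarith)
  set r : NNReal := n / 2 with hr
  have hr2 : (r : ℝ) * (4 * ε ^ 2) = 2 * n * ε ^ 2 := by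
    rw [hr]; push_cast; ring
  let X : Fin m → (Fin m → Fin B) → ℝ≥0∞ := fun b K => ∫⁻ ω, likelihood ε j (pickCells K) ω *
    blockLoss fhat ε j (pickCells K) (blockCells B b) (toConfig ω) ∂(sampleLaw r unif)
  have hmeas : ∀ (b : Fin m) (K : Fin m → Fin B), Measurable fun ω => likelihood ε j (pickCells K) ω *
      blockLoss fhat ε j (pickCells K) (blockCells B b) (toConfig ω) := fun b K =>
    (measurable_likelihood ε j _).mul ((measurable_blockLoss hf ε j _ _).comp measurable_toConfig)
  have hrisk : ∀ K, ∑ b, X b K ≤ c := fun K => by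
    refine le_trans ?_ (hc _ (pickCells_subset hmB K) (card_pickCells K))
    rw [risk_modelLaw n ε j _ hf, ← lintegral_finsetSum _ fun b _ => hmeas b K]
    refine lintegral_mono fun ω => ?_
    rw [← Finset.mul_sum]
    exact mul_le_mul_right (sum_blockLoss_le fhat ε j _ (fun b b' h => disjoint_blockCells h) _) _
  -- Freeze the bumps in the other blocks and let only the position in block `b` vary.
  have hblock : ∀ b K, ENNReal.ofReal (B * (ε ^ 2 / 8)) ≤ ∑ k, X b (Function.update K b k) := by
    intro b K
    have h := sum_lintegral_blockLoss_ge hf r hε (disjoint_otherCells K b)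
      (blockCells_subset hmB b) (by rwa [card_blockCells, hr2])
    rw [card_blockCells, blockCells, Finset.sum_image fun _ _ _ _ h => blockCell_injective b h] at h
    simp only [X, pickCells_update]
    exact h
  have hsum : ∀ b, (Fintype.card (Fin m → Fin B) : ℝ≥0∞) * ENNReal.ofReal (ε ^ 2 / 8)
      ≤ ∑ K, X b K := fun b => by
    have h1 := Finset.sum_le_sum fun K (_ : K ∈ Finset.univ) => hblock b K
    rw [sum_sum_update, Finset.sum_const, Finset.card_univ, Fintype.card_fin, nsmul_eq_mul,
      nsmul_eq_mul, ENNReal.ofReal_mul (Nat.cast_nonneg B), ENNReal.ofReal_natCast,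
      mul_left_comm] at h1
    exact (ENNReal.mul_le_mul_iff_right (by exact_mod_cast hB0.ne')
      (ENNReal.natCast_ne_top B)).1 h1
  -- The maximum over positions dominates the average; the number of choices `K` cancels from both
  -- sides.
  have htot := Finset.sum_le_sum fun K (_ : K ∈ Finset.univ) => hrisk K
  rw [Finset.sum_comm, Finset.sum_const, Finset.card_univ, nsmul_eq_mul] at htot
  have hlow := (Finset.sum_le_sum fun b (_ : b ∈ Finset.univ) => hsum b).trans htot
  rw [Finset.sum_const, Finset.card_univ, Fintype.card_fin, nsmul_eq_mul, mul_left_comm] at hlow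
  have : Nonempty (Fin B) := ⟨⟨0, hB0⟩⟩
  rw [ENNReal.ofReal_mul (Nat.cast_nonneg m), ENNReal.ofReal_natCast]
  exact (ENNReal.mul_le_mul_iff_right (by exact_mod_cast Fintype.card_ne_zero)
    (ENNReal.natCast_ne_top _)).1 hlow

theorem minimaxRisk_ge {m B j n : ℕ} (hmB : m * B ≤ 2 ^ j) {ε s R R' R'' : ℝ} (hε0 : 0 < ε)
    (hε : ε ^ 2 * 2 ^ j ≤ 1 / 4) (hB : 16 * Real.exp (2 * n * ε ^ 2) ≤ B) (hs : 0 < s)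
    (hs1 : s < 1 / 2) (hW : 1 / 2 + m * ε ^ (2 - 4 * s) ≤ R ^ (2 - 4 * s))
    (hT : m * (((2 : ℝ) ^ j) ^ (2 * s) * ε ^ 2) ≤ R' ^ 2) (hL : 1 ≤ R'') :
    ENNReal.ofReal (m * (ε ^ 2 / 8)) ≤ minimaxRisk n
      (weakBesovBall s R ∩ tailBall levelSet s R' ∩ lebesgueBall R'') := by
  refine le_iInf₂ fun fhat hf => le_of_forall_risk_le hmB hε hB hf fun T hTs hTc => ?_
  refine le_iSup_of_le (intensity ε j T) (le_iSup_of_le ?_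
    (le_iSup_of_le (modelLaw n ε j T) (le_iSup_of_le (isPoissonModel_modelLaw n hTs hε) le_rfl)))
  exact ⟨⟨intensity_mem_weakBesovBall hTs hε hε0 hs hs1 (by rwa [hTc]),
    intensity_mem_tailBall hTs hε hs (by rwa [hTc])⟩, intensity_mem_lebesgueBall hTs hε hL⟩

/-! ### The lower bound -/

theorem eventually_log_le : ∀ᶠ n : ℕ in atTop, Real.log n ≤ (n : ℝ) ^ (1 / 4 : ℝ) := by
  have h := (isLittleO_log_rpow_atTop (show (0 : ℝ) < 1 / 4 by norm_num)).bound zero_lt_one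
  filter_upwards [tendsto_natCast_atTop_atTop.eventually h] with n hn
  rw [one_mul, Real.norm_of_nonneg (show (0 : ℝ) ≤ (n : ℝ) ^ (1 / 4 : ℝ) by positivity)] at hn
  exact (le_abs_self _).trans hn

theorem eventually_le_rpow (a c : ℝ) (ha : 0 < a) : ∀ᶠ n : ℕ in atTop, c ≤ (n : ℝ) ^ a :=
  ((tendsto_rpow_atTop ha).comp tendsto_natCast_atTop_atTop).eventually_ge_atTop c

theorem rate_zpow (s : ℝ) {n : ℕ} (hn : 2 ≤ n) :
    rate s n ^ (-2 : ℤ) = ((n : ℝ) / Real.log n) ^ (2 * s) := by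
  have hlog : 0 < Real.log n := Real.log_pos (by exact_mod_cast hn)
  have hx : 0 ≤ (n : ℝ) / Real.log n := by positivity
  rw [rate, ← inv_div, Real.inv_rpow hx, inv_zpow', neg_neg, ← Real.rpow_intCast,
    ← Real.rpow_mul hx]
  push_cast
  ring_nf

end WeakBesov

end

theorem theorem6 (s : ℝ) (hs0 : 0 < s) (hs1 : s < 1 / 2) :
    ∃ C : ℝ, 0 < C ∧ ∀ R R' R'' : ℝ, 0 < R → 0 < R' → 0 < R'' →
      1 ≤ R'' → R ^ (1 - 2 * s) ≤ R' → 1 ≤ R ^ (1 - 2 * s) →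
      ENNReal.ofReal (C * R ^ (2 - 4 * s)) ≤
        Filter.liminf
          (fun n : ℕ => ENNReal.ofReal (WeakBesov.rate s n ^ (-2 : ℤ)) *
            WeakBesov.minimaxRisk n
              (WeakBesov.weakBesovBall s R ∩ WeakBesov.tailBall WeakBesov.levelSet s R' ∩
                WeakBesov.lebesgueBall R''))
          Filter.atTop := by
  -- In mε²/8, use m ≥ (A/4) x^(1-2s) and ε²/8 = s/(16x), where A = R^(2-4s) and x = n / log n.
  refine ⟨s / 64, by positivity, fun R R' R'' hR hR' _ hR''1 hRR' hR1 => ?_⟩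
  refine le_liminf_of_le (by isBoundedDefault) ?_
  set A := R ^ (2 - 4 * s) with hA
  have hAsq : A = (R ^ (1 - 2 * s)) ^ 2 := by
    rw [hA, ← Real.rpow_natCast, ← Real.rpow_mul hR.le]
    push_cast
    ring_nf
  have hA1 : 1 ≤ A := by rw [hAsq]; exact one_le_pow₀ hR1
  have hAR' : A ≤ R' ^ 2 := by rw [hAsq]; gcongr
  -- Since x ≥ n^(3/4), the third condition gives x^(2s) ≥ 17A n^s (16 for the block size, 1 for
  -- rounding it down); the fourth gives x^(1-2s) ≥ 2, so at least one bump fits.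
  filter_upwards [eventually_ge_atTop 2, WeakBesov.eventually_log_le,
    WeakBesov.eventually_le_rpow (s / 2) (17 * A) (by positivity),
    WeakBesov.eventually_le_rpow (3 / 4 * (1 - 2 * s)) 2 (by linarith)] with n hn hlogle hns hn2
  have hlog : 0 < Real.log n := Real.log_pos (by exact_mod_cast hn)
  have hn0 : (0 : ℝ) < n := by positivity
  set x := (n : ℝ) / Real.log n with hx
  have hx0 : 0 < x := by positivity
  have hxn : (n : ℝ) ^ (3 / 4 : ℝ) ≤ x := by
    rw [hx, le_div_iff₀ hlog]
    calc (n : ℝ) ^ (3 / 4 : ℝ) * Real.log n ≤ (n : ℝ) ^ (3 / 4 : ℝ) * (n : ℝ) ^ (1 / 4 : ℝ) := by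
          gcongr
      _ = n := by rw [← Real.rpow_add hn0]; norm_num
  have hx2 : 2 ≤ x ^ (1 - 2 * s) := by
    refine hn2.trans ?_
    rw [Real.rpow_mul hn0.le]
    exact Real.rpow_le_rpow (by positivity) hxn (by linarith)
  have hx3 : 17 * A * (n : ℝ) ^ s ≤ x ^ (2 * s) := by
    calc 17 * A * (n : ℝ) ^ s ≤ (n : ℝ) ^ (s / 2) * (n : ℝ) ^ s := by gcongr
      _ = ((n : ℝ) ^ (3 / 4 : ℝ)) ^ (2 * s) := by
        rw [← Real.rpow_add hn0, ← Real.rpow_mul hn0.le]; ring_nf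
      _ ≤ x ^ (2 * s) := Real.rpow_le_rpow (by positivity) hxn (by positivity)
  have hx1 : 1 ≤ x := by
    by_contra h
    have := Real.rpow_le_one hx0.le (not_le.1 h).le (show 0 ≤ 1 - 2 * s by linarith)
    linarith
  obtain ⟨j, hj1, hj2⟩ : ∃ j : ℕ, (2 : ℝ) ^ j ≤ x ∧ x < 2 ^ (j + 1) := by
    exact exists_nat_pow_near hx1 one_lt_two
  -- The bumps use half of the weak Besov budget A; the father takes 1/2 ≤ A/2 of the rest.
  set y := A / 2 * x ^ (1 - 2 * s) with hy
  have hy1 : 1 ≤ y := by nlinarith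
  set m := ⌊y⌋₊
  have hmy : (m : ℝ) ≤ y := Nat.floor_le (by linarith)
  have hm1 : 1 ≤ m := Nat.one_le_floor_iff _ |>.2 hy1
  have hm0 : (0 : ℝ) < m := by exact_mod_cast hm1
  have hmy2 : y / 2 ≤ m := by
    have := Nat.lt_floor_add_one y
    have : (1 : ℝ) ≤ m := by exact_mod_cast hm1
    linarith
  have hxx : x ^ (1 - 2 * s) * x ^ (2 * s) = x := by
    rw [← Real.rpow_add hx0]; ring_nf; exact Real.rpow_one x
  -- This makes exp(2nε²) = n^s, a smaller power of n than the x^(2s) governing the block size.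
  set ε := √(s / 2 / x)
  have hε0 : 0 < ε := by positivity
  have hεsq : ε ^ 2 = s / 2 / x := Real.sq_sqrt (by positivity)
  have hεj : ε ^ 2 * 2 ^ j ≤ 1 / 4 := by
    rw [hεsq, div_mul_eq_mul_div, div_le_iff₀ hx0]
    nlinarith
  have hnε : 2 * n * ε ^ 2 = Real.log n * s := by
    rw [hεsq, hx]
    field_simp
  have hB : 16 * Real.exp (2 * n * ε ^ 2) ≤ ((2 ^ j / m : ℕ) : ℝ) := by
    rw [hnε, ← Real.rpow_def_of_pos hn0]
    have h1 : (2 : ℝ) ^ j / m < ((2 ^ j / m : ℕ) : ℝ) + 1 := by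
      have := Nat.lt_floor_add_one ((2 : ℝ) ^ j / m)
      rw [show (2 : ℝ) ^ j = ((2 ^ j : ℕ) : ℝ) by push_cast; rfl] at this ⊢
      rwa [Nat.floor_div_eq_div] at this
    have h2 : 17 * (n : ℝ) ^ s ≤ 2 ^ j / m := by
      rw [le_div_iff₀ hm0]
      have h3 : 17 * (n : ℝ) ^ s * y ≤ x / 2 := by
        calc 17 * (n : ℝ) ^ s * y = (17 * A * (n : ℝ) ^ s) * x ^ (1 - 2 * s) / 2 := by
              rw [hy]; ring
          _ ≤ x ^ (2 * s) * x ^ (1 - 2 * s) / 2 := by gcongr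
          _ = x / 2 := by rw [mul_comm, hxx]
      calc 17 * (n : ℝ) ^ s * m ≤ 17 * (n : ℝ) ^ s * y := by gcongr
        _ ≤ x / 2 := h3
        _ ≤ 2 ^ j := by rw [pow_succ] at hj2; linarith
    have h4 : 1 ≤ (n : ℝ) ^ s := Real.one_le_rpow (by exact_mod_cast (by omega)) hs0.le
    linarith
  have hW : 1 / 2 + m * ε ^ (2 - 4 * s) ≤ A := by
    have h1 : ε ^ (2 - 4 * s) ≤ (x ^ (1 - 2 * s))⁻¹ := by
      have : ε ^ (2 - 4 * s) = (s / 2 / x) ^ (1 - 2 * s) := by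
        rw [← hεsq, ← Real.rpow_natCast, ← Real.rpow_mul hε0.le]
        push_cast
        ring_nf
      rw [this, ← Real.inv_rpow hx0.le]
      refine Real.rpow_le_rpow (by positivity) ?_ (by linarith)
      rw [div_eq_mul_inv]
      exact mul_le_of_le_one_left (by positivity) (by linarith)
    have h2 : m * ε ^ (2 - 4 * s) ≤ A / 2 := by
      calc m * ε ^ (2 - 4 * s) ≤ y * (x ^ (1 - 2 * s))⁻¹ := by gcongr
        _ = A / 2 := by rw [hy]; field_simp
    linarith
  have hT : m * (((2 : ℝ) ^ j) ^ (2 * s) * ε ^ 2) ≤ R' ^ 2 := by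
    calc m * (((2 : ℝ) ^ j) ^ (2 * s) * ε ^ 2) ≤ y * (x ^ (2 * s) * (s / 2 / x)) := by
          rw [hεsq]; gcongr
      _ = A * s / 4 * (x ^ (1 - 2 * s) * x ^ (2 * s)) / x := by rw [hy]; ring
      _ = A * s / 4 := by rw [hxx]; field_simp
      _ ≤ R' ^ 2 := by nlinarith
  have hrisk := WeakBesov.minimaxRisk_ge (n := n) (Nat.mul_div_le (2 ^ j) m) hε0 hεj hB hs0 hs1
    hW hT hR''1
  refine le_trans ?_ (mul_le_mul_right hrisk _)
  rw [WeakBesov.rate_zpow s hn, ← ENNReal.ofReal_mul (by positivity)]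
  refine ENNReal.ofReal_le_ofReal ?_
  calc s / 64 * A = x ^ (2 * s) * (y / 2 * (s / 2 / x / 8)) := by
        rw [hy]
        have : x ^ (2 * s) * (A / 2 * x ^ (1 - 2 * s) / 2 * (s / 2 / x / 8))
          = A * s / 64 * (x ^ (1 - 2 * s) * x ^ (2 * s)) / x := by ring
        rw [this, hxx]
        field_simp
    _ ≤ x ^ (2 * s) * (m * (ε ^ 2 / 8)) := by rw [hεsq]; gcongr
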